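/- **Setting.** Let $d\ge 1$, $p\ge 0$, $\alpha>0$, $\beta\in(0,\infty]$, and for $r\in(0,\infty]$ let $\overline B_r=\{z\in\mathbb R^d:|z_i|\le r\ \forall i\}$ (so $\overline B_\infty=\mathbb R^d$). Let $\kappa>\beta+\frac{\alpha}{2}$ (with $\kappa=\infty$ if $\beta=\infty$). Let $\xi\in\mathbb R^p$ be a random vector with law $P_\xi$, and let $F:\overline B_\kappa\times\mathbb R^p\to\mathbb R$ be Borel measurable, continuous in $w$ for every $\xi$, with $F(w,\cdot)$ $P_\xi$-integrable for every $w\in\overline B_\kappa$, and such that for $P_\xi$-almost every $\xi$, $|F(w,\xi)-F(w',\xi)|\le L_0(\xi)\|w-w'\|_2$ for all $w,w'\in\overline B_\kappa$, where $L_0(\cdot)$ is measurable and $Q:=\mathbb E[L_0(\xi)^2]<\infty$. Put $L_0:=\mathbb E[L_0(\xi)]$ and assume $L_0>0$. Let $f(w)=\mathbb E[F(w,\xi)]$ and $f_\alpha(w)=\mathbb E[f(w+u)]$, where $u$ is uniformly distributed on $\overline B_{\alpha/2}$ with law $P_u$. For $i=1,\dots,d$ let $dF_i(w,u,\xi)$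 be the difference of the values of $F(\cdot,\xi)$ at the two points that agree with $w+u$ in all coordinates except the $i$-th, where they equal $w_i+\frac\alpha2$ and $w_i-\frac\alpha2$ respectively; $dF=(dF_1,\dots,dF_d)$. In the first-order version let $\widetilde\nabla F$ be a Borel measurable function on $\overline B_{\beta+\alpha/2}\times\mathbb R^p$ such that for every $w\in\overline B_\beta$, $\widetilde\nabla F(w+u,\xi)=\nabla F(w+u,\xi)$ (gradient in the first variable) for $P_u\times P_\xi$-almost every $(u,\xi)$. **Algorithm (SPA).** Let $S\subseteq\mathbb R^d$ be closed, $w^1\in S\cap\overline B_\beta$, $\eta>0$ and $K,M\in\mathbb Z_{>0}$. Draw $R$ uniformly from $\{2,\dots,K+1\}$, and for $k=1,\dots,K$, $i=1,\dots,M$ draw $u^{k,i}\sim P_u$ and $\xi^{k,i}\sim P_\xi$, all mutually independent. For $k=1,2,\dots$ let $w^{k+1}$ be a Euclidean projection onto $S\cap\overline B_\beta$ of $w^k-\eta G^k$, chosen measurably from the samples drawn so far, where (1) (zeroth order) $G^k=\frac1{M\alpha}\sum_{i=1}^M dF(w^k,u^{k,i},\xi^{k,i})$, or (2) (first order) $G^k=\frac1M\sum_{i=1}^M\widetilde\nabla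 F(w^k+u^{k,i},\xi^{k,i})$. The output is $w^R$. **Normal cones.** For $w\in A$ let $\widehat N(w,A)=\{y:\limsup_{x\to w,\,x\in A,\,x\neq w}\langle y,x-w\rangle/\|x-w\|_2\le 0\}$, and let the Mordukhovich normal cone $N(w,A)$ be the set of all limits of sequences $y_k\in\widehat N(x_k,A)$ with $x_k\in A$, $x_k\to w$; $N(w,A)=\emptyset$ for $w\notin A$. **Theorem.** Let $\rho>0$, $\tau\ge 0$ with $\rho+\tau>1$, and let SPA be run with $\eta=\frac{\alpha}{3\rho\sqrt d L_0}$, from any $w^1\in S\cap\overline B_\beta$ and with any $K,M\in\mathbb Z_{>0}$. Let $w^*_\alpha$ be a minimizer of $f_\alpha$ over $S\cap\overline B_\beta$. Then $f_\alpha$ is differentiable at every point of $\overline B_\beta$, $\operatorname{dist}(0,\nabla f_\alpha(w^R)+N(w^R,S\cap\overline B_\beta))$ is (almost everywhere) measurable, and for every $\Delta\ge f_\alpha(w^1)-f_\alpha(w^*_\alpha)$, $$\mathbb E\big[\operatorname{dist}(0,\nabla f_\alpha(w^R)+N(w^R,S\cap\overline B_\beta))^2\big]\le C_1\frac{2\alpha^{-1}\sqrt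 d L_0\Delta}{K}+C_2\frac{\upsilon Q}{M},$$ where $C_1=\frac{2(1+3\rho)}{\tau+\rho-1}+3\rho$, $C_2=\frac{4(1+3\rho)}{\tau+\rho-1}\Big(\frac12+\frac23\frac{M\tau}{\rho^2}\Big)+3$, and $\upsilon=d$ for version (1), $\upsilon=1$ for version (2). Moreover, for every minimizer $w^*$ of $f$ over $S\cap\overline B_\beta$, $$f_\alpha(w^1)-f_\alpha(w^*_\alpha)\le\min\Big(2\beta\sqrt d L_0,\ f(w^1)-f(w^*)+\alpha L_0\sqrt{\tfrac d3}\Big).$$ -/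

import Mathlib

open MeasureTheory ProbabilityTheory Filter Topology
open scoped ENNReal

namespace SPA

/-- `ℝ^d` with the Euclidean norm. -/
abbrev Vec (d : ℕ) : Type := EuclideanSpace ℝ (Fin d)

noncomputable section

/-- The closed `l_∞`-ball of radius `r` centred at `0`; `r = ⊤` gives the whole space. -/
def box {d : ℕ} (r : EReal) : Set (Vec d) := {z | ∀ i, ((|z i| : ℝ) : EReal) ≤ r}

/-- The Fréchet normal cone: all `y` with
`limsup ⟪y, x - w⟫ / ‖x - w‖ ≤ 0` as `x → w`, `x ∈ S`, `x ≠ w`; it is empty when `w ∉ S`.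
The `limsup` is taken in the extended reals, so that it is `-∞` at isolated points of `S`. -/
def frechetNormalCone {d : ℕ} (w : Vec d) (S : Set (Vec d)) : Set (Vec d) :=
  {y | w ∈ S ∧
    limsup (fun x : Vec d => ((inner ℝ y (x - w) / ‖x - w‖ : ℝ) : EReal)) (𝓝[S \ {w}] w) ≤ 0}

/-- The Mordukhovich (limiting) normal cone, empty when `w ∉ S`. -/
def mordukhovichNormalCone {d : ℕ} (w : Vec d) (S : Set (Vec d)) : Set (Vec d) :=
  {y | w ∈ S ∧ ∃ x v : ℕ → Vec d,
    (∀ k, x k ∈ S) ∧ Tendsto x atTop (𝓝 w) ∧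
    (∀ k, v k ∈ frechetNormalCone (x k) S) ∧ Tendsto v atTop (𝓝 y)}

/-- The set of Euclidean projections of `x` onto `A`. -/
def proj {d : ℕ} (A : Set (Vec d)) (x : Vec d) : Set (Vec d) :=
  {y | y ∈ A ∧ ∀ z ∈ A, ‖y - x‖ ≤ ‖z - x‖}

/-- The expected loss `f(w) = E[F(w, ξ)]`. -/
def expLoss {d p : ℕ} (F : Vec d → Vec p → ℝ) (Pξ : Measure (Vec p)) (w : Vec d) : ℝ :=
  ∫ x, F w x ∂Pξ

/-- The uniform distribution on the closed `l_∞`-ball of radius `α / 2`. -/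
def unifBox (d : ℕ) (α : ℝ) : Measure (Vec d) :=
  ProbabilityTheory.cond volume (box ((α / 2 : ℝ) : EReal))

/-- The smoothed function `f_α(w) = E[f(w + u)]`, `u` uniform on the `l_∞`-ball of radius
`α / 2`. -/
def smoothed {d : ℕ} (f : Vec d → ℝ) (α : ℝ) (w : Vec d) : ℝ :=
  ∫ u, f (w + u) ∂(unifBox d α)

/-- The finite-difference vector `dF(w, u, ξ)`: its `i`-th component is the difference of
`F(·, ξ)` at the two points which agree with `w + u` off the `i`-th coordinate and whose `i`-th
coordinates are `w_i + α / 2` and `w_i - α / 2`. -/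
def finDiff {d p : ℕ} (F : Vec d → Vec p → ℝ) (α : ℝ) (w u : Vec d) (x : Vec p) : Vec d :=
  WithLp.toLp 2 fun i =>
    F (WithLp.toLp 2 (Function.update (WithLp.ofLp (w + u)) i (w i + α / 2))) x -
      F (WithLp.toLp 2 (Function.update (WithLp.ofLp (w + u)) i (w i - α / 2))) x

/-- The standing assumptions on the stochastic loss: `F` is Borel measurable on
`box κ × ℝ^p`, `F(·, ξ)` is continuous on `box κ` for every `ξ` and `L(ξ)`-Lipschitz on `box κ` for
almost every `ξ`, `F(w, ·)` is integrable, and `L` is measurable and square integrable.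
Values of `F` for `w` outside `box κ` are irrelevant. -/
structure IsStochasticLoss {d p : ℕ} (κ : EReal) (F : Vec d → Vec p → ℝ) (L : Vec p → ℝ)
    (Pξ : Measure (Vec p)) : Prop where
  measurable : Measurable fun z : ↥(box (d := d) κ) × Vec p => F z.1 z.2
  continuousOn : ∀ x, ContinuousOn (fun w => F w x) (box κ)
  integrable : ∀ w ∈ (box κ : Set (Vec d)), Integrable (F w) Pξ
  measurable_L : Measurable L
  lipschitz : ∀ᵐ x ∂Pξ, ∀ w ∈ (box κ : Set (Vec d)), ∀ w' ∈ (box κ : Set (Vec d)),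
    |F w x - F w' x| ≤ L x * ‖w - w'‖
  sq_integrable : Integrable (fun x => L x ^ 2) Pξ

/-- `gF` is an almost-everywhere gradient of `F`: it is Borel measurable on
`box (β + α / 2) × ℝ^p` and, for every `w ∈ box β`, it equals `∇F(w + u, ξ)` (the gradient in
the first variable) for almost every `(u, ξ)`. -/
structure IsAEGradient {d p : ℕ} (β : EReal) (α : ℝ) (F : Vec d → Vec p → ℝ)
    (Pξ : Measure (Vec p)) (gF : Vec d → Vec p → Vec d) : Prop where
  measurable : Measurable fun z : ↥(box (d := d) (β + ((α / 2 : ℝ) : EReal))) × Vec p =>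
    gF z.1 z.2
  ae_eq : ∀ w ∈ (box β : Set (Vec d)), ∀ᵐ z ∂((unifBox d α).prod Pξ),
    gF (w + z.1) z.2 = gradient (fun y => F y z.2) (w + z.1)

/-- The two versions of the algorithm. -/
inductive Version : Type
  | zerothOrder
  | firstOrder

/-- The factor `υ`: `d` for the zeroth-order and `1` for the first-order version. -/
def Version.factor (v : Version) (d : ℕ) : ℝ :=
  match v with
  | .zerothOrder => d
  | .firstOrder => 1

/-- The mini-batch search direction at `w`, from `M` samples of `u` and `ξ`:
`(M α)⁻¹ ∑ dF(w, u^i, ξ^i)` (zeroth order) or `M⁻¹ ∑ gF(w + u^i, ξ^i)` (first order). -/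
def direction {d p M : ℕ} (v : Version) (F : Vec d → Vec p → ℝ) (gF : Vec d → Vec p → Vec d)
    (α : ℝ) (w : Vec d) (u : Fin M → Vec d) (x : Fin M → Vec p) : Vec d :=
  match v with
  | .zerothOrder => (1 / ((M : ℝ) * α)) • ∑ i, finDiff F α w (u i) (x i)
  | .firstOrder => (1 / (M : ℝ)) • ∑ i, gF (w + u i) (x i)

/-- The `σ`-algebra generated by all samples drawn in the iterations `1, …, k`. -/
@[reducible] def history {Ω : Type*} {d p M : ℕ} (u : ℕ → Fin M → Ω → Vec d) (ξ : ℕ → Fin M → Ω → Vec p)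
    (k : ℕ) : MeasurableSpace Ω :=
  ⨆ j ∈ Finset.Icc 1 k, ⨆ i : Fin M,
    MeasurableSpace.comap (fun ω => (u j i ω, ξ j i ω)) inferInstance

/-- A run of the stochastic projected algorithm onto the set `A` with step size `η`, `K` iterations
and batch size `M`, on the probability space `(Ω, P)`.

The samples `u^{k,i}` (uniform on the `l_∞`-ball of radius `α / 2`), `ξ^{k,i}` (law `Pξ`), for
`1 ≤ k ≤ K` and `i = 1, …, M`, and the index `R` (uniform on `{2, …, K + 1}`) are mutually
independent.  The iterates start at `w1`, and `w^{k+1}` is a projection onto `A` of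
`w^k - η G^k`, where `G^k` is the mini-batch direction.  Where the projection is not unique the
element is selected measurably from the samples seen so far (in particular, any Borel measurable
selection of the projection mapping is allowed).  The output of the algorithm is `w^R`. -/
structure IsRun {Ω : Type*} [MeasurableSpace Ω] {d p M : ℕ} (P : Measure Ω) (v : Version)
    (F : Vec d → Vec p → ℝ) (gF : Vec d → Vec p → Vec d) (Pξ : Measure (Vec p)) (α : ℝ)
    (A : Set (Vec d)) (w1 : Vec d) (η : ℝ) (K : ℕ)
    (u : ℕ → Fin M → Ω → Vec d) (ξ : ℕ → Fin M → Ω → Vec p) (R : Ω → ℕ)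
    (w : ℕ → Ω → Vec d) : Prop where
  measurable_u : ∀ k ∈ Finset.Icc 1 K, ∀ i, Measurable (u k i)
  measurable_ξ : ∀ k ∈ Finset.Icc 1 K, ∀ i, Measurable (ξ k i)
  measurable_R : Measurable R
  law_sample : ∀ k ∈ Finset.Icc 1 K, ∀ i,
    P.map (fun ω => (u k i ω, ξ k i ω)) = (unifBox d α).prod Pξ
  law_R : P.map R = uniformOn (Set.Icc 2 (K + 1))
  indep_samples : iIndepFun
    (fun (ki : (Finset.Icc 1 K : Finset ℕ) × Fin M) ω => (u ki.1 ki.2 ω, ξ ki.1 ki.2 ω)) P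
  indep_R : IndepFun R
    (fun ω (ki : (Finset.Icc 1 K : Finset ℕ) × Fin M) => (u ki.1 ki.2 ω, ξ ki.1 ki.2 ω)) P
  init : ∀ ω, w 1 ω = w1
  adapted : ∀ k ∈ Finset.Icc 1 K, Measurable[history u ξ k] (w (k + 1))
  step : ∀ k ∈ Finset.Icc 1 K, ∀ᵐ ω ∂P, w (k + 1) ω ∈
    proj A (w k ω - η • direction v F gF α (w k ω) (fun i => u k i ω) (fun i => ξ k i ω))

/-- `dist(0, ∇g(w) + N(w, A))`, with values in `[0, ∞]` (it is `∞` only if `w ∉ A`). -/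
def statDist {d : ℕ} (g : Vec d → ℝ) (A : Set (Vec d)) (w : Vec d) : ℝ≥0∞ :=
  Metric.infEDist 0 ((fun y => gradient g w + y) '' mordukhovichNormalCone w A)

/-- The constant `C₁`. -/
def constC1 (ρ τ : ℝ) : ℝ := 2 * (1 + 3 * ρ) / (τ + ρ - 1) + 3 * ρ

/-- The constant `C₂`. -/
def constC2 (ρ τ : ℝ) (M : ℕ) : ℝ :=
  4 * (1 + 3 * ρ) / (τ + ρ - 1) * (1 / 2 + 2 / 3 * (M * τ / ρ ^ 2)) + 3

end

end SPA

/-!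
The smoothed objective `f_α` is a `C^{1,1}` function with gradient constant
`ℓ = 2 α⁻¹ √d L₀`, and the run is a projected stochastic gradient method on it with step size
`η = 2 / (3 ρ ℓ)`.

*Smoothing.* All values of `F` that matter lie in `box κ`, so a Lipschitz function on `box κ` may be
replaced by a global Lipschitz extension (`smoothed_eventuallyEq`). For globally Lipschitz `g`,
Rademacher's theorem and differentiation under the integral give `∇g_α(w) = E[∇g(w + u)]`
(`hasGradientAt_smoothed`). Redrawing the `i`-th coordinate of `u` preserves its law, and the
fundamental theorem of calculus in that coordinate gives `∂_i g_α(w) = α⁻¹ E[dg_i(w, u)]`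
(`integral_gradient_apply`), whence the Lipschitz bound on the gradient. Applied to `f` and to
almost every `F(·, ξ)`, these formulas show that both versions of the search direction are unbiased
with second moment at most `υ Q` (`exists_oracle_direction`).

*One run.* The projection inequality and the descent lemma give sufficient decrease with an error
`‖G - ∇f_α‖²` (`descent_step`). The scaled residual of the projection is a normal vector, and
expanding the square of `∇f_α(w^{k+1})` plus this normal shows that the squared stationarity
distance is at most `3 ρ ℓ` times the decrease, plus error and displacement terms
(`exists_norm_gradient_add_normal_sq_le`). Both estimates telescope along each sample path, so the
function values need not be integrated (`sum_statDist_sq_le`).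

*Expectation.* The current iterate is independent of the next batch, so the errors are bounded by
the variance of a mini-batch average (`lintegral_norm_sq_average_sub_le`). The output index is
independent of the samples, so the expectation at the output is the average over the iterates
(`IsRun.lintegral_output`). Measurability holds because the stationarity distance is lower
semicontinuous (`isClosed_statDist_le`).
-/

namespace SPA

/-! ### The uniform distribution on a box -/

/-- The one-dimensional uniform distribution on `[-α / 2, α / 2]`; `unifBox d α` is its `d`-fold
product. -/
noncomputable def unifInterval (α : ℝ) : Measure ℝ :=
  ProbabilityTheory.cond volume (Set.Icc (-(α / 2)) (α / 2))

section UniformBox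

variable {d : ℕ} {α : ℝ}

lemma box_coe_eq_preimage (r : ℝ) :
    (box (r : EReal) : Set (Vec d)) =
      WithLp.ofLp ⁻¹' (Set.univ.pi fun _ : Fin d => Set.Icc (-r) r) := by
  ext z
  simp only [box, Set.mem_ofPred_eq, EReal.coe_le_coe_iff, abs_le, Set.mem_preimage, Set.mem_pi,
    Set.mem_univ, true_imp_iff, Set.mem_Icc]

lemma isClosed_box (r : EReal) : IsClosed (box r : Set (Vec d)) := by
  have : (box r : Set (Vec d)) = ⋂ i, {z : Vec d | ((|z i| : ℝ) : EReal) ≤ r} := by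
    ext z; simp [box]
  rw [this]
  refine isClosed_iInter fun i => isClosed_le ?_ continuous_const
  exact continuous_coe_real_ereal.comp (by fun_prop)

lemma volume_Icc_half (α : ℝ) :
    volume (Set.Icc (-(α / 2)) (α / 2)) = ENNReal.ofReal α := by
  rw [Real.volume_Icc]; ring_nf

lemma isProbabilityMeasure_unifInterval (hα : 0 < α) : IsProbabilityMeasure (unifInterval α) := by
  refine cond_isProbabilityMeasure_of_finite ?_ ?_ <;> rw [volume_Icc_half]
  · simpa using hα
  · exact ENNReal.ofReal_ne_top

lemma volume_box_half (α : ℝ) :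
    volume (box ((α / 2 : ℝ) : EReal) : Set (Vec d)) = ENNReal.ofReal α ^ d := by
  rw [box_coe_eq_preimage, (PiLp.volume_preserving_ofLp (Fin d)).measure_preimage, volume_pi_pi]
  · simp
  · exact (MeasurableSet.univ_pi fun _ => measurableSet_Icc).nullMeasurableSet

lemma isProbabilityMeasure_unifBox (hα : 0 < α) : IsProbabilityMeasure (unifBox d α) := by
  refine cond_isProbabilityMeasure_of_finite ?_ ?_ <;> rw [volume_box_half]
  · simp [hα]
  · exact ENNReal.pow_ne_top ENNReal.ofReal_ne_top

lemma ae_mem_box (d : ℕ) (α : ℝ) :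
    ∀ᵐ u ∂(unifBox d α), u ∈ (box ((α / 2 : ℝ) : EReal) : Set (Vec d)) :=
  ae_cond_mem (isClosed_box _).measurableSet

lemma unifBox_absolutelyContinuous : unifBox d α ≪ volume := cond_absolutelyContinuous

/-- A property that holds Lebesgue almost everywhere holds almost surely at the randomly shifted
point `w + u`. -/
lemma ae_shift_of_ae_volume {q : Vec d → Prop} (hq : ∀ᵐ x ∂volume, q x) (w : Vec d) :
    ∀ᵐ u ∂(unifBox d α), q (w + u) :=
  unifBox_absolutelyContinuous.ae_le
    ((measurePreserving_add_left volume w).quasiMeasurePreserving.ae hq)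

lemma map_ofLp_unifBox (hα : 0 < α) :
    (unifBox d α).map WithLp.ofLp = Measure.pi fun _ : Fin d => unifInterval α := by
  have := isProbabilityMeasure_unifInterval hα
  have hm : Measurable (WithLp.ofLp : Vec d → (Fin d → ℝ)) := by fun_prop
  refine (Measure.pi_eq fun s hs => ?_).symm
  rw [Measure.map_apply hm (MeasurableSet.univ_pi hs), unifBox,
    cond_apply (isClosed_box _).measurableSet, volume_box_half, box_coe_eq_preimage,
    ← Set.preimage_inter, ← Set.pi_inter_distrib,
    (PiLp.volume_preserving_ofLp (Fin d)).measure_preimage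
      (MeasurableSet.univ_pi fun i => measurableSet_Icc.inter (hs i)).nullMeasurableSet,
    volume_pi_pi]
  simp only [unifInterval, cond_apply measurableSet_Icc, volume_Icc_half]
  rw [Finset.prod_mul_distrib]
  simp [ENNReal.inv_pow]

lemma measurePreserving_ofLp_unifBox (hα : 0 < α) :
    MeasurePreserving (WithLp.ofLp : Vec d → (Fin d → ℝ)) (unifBox d α)
      (Measure.pi fun _ : Fin d => unifInterval α) :=
  ⟨by fun_prop, map_ofLp_unifBox hα⟩

/-- Redrawing the `i`-th coordinate of a uniform vector independently leaves its law unchanged. -/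
lemma measurePreserving_resample (hα : 0 < α) (i : Fin d) :
    MeasurePreserving
      (fun z : Vec d × ℝ => (WithLp.toLp 2 (Function.update (WithLp.ofLp z.1) i z.2) : Vec d))
      ((unifBox d α).prod (unifInterval α)) (unifBox d α) := by
  have := isProbabilityMeasure_unifInterval hα
  have := isProbabilityMeasure_unifBox (d := d) hα
  have hupd : Measurable fun z : (Fin d → ℝ) × ℝ => Function.update z.1 i z.2 := by
    refine measurable_pi_iff.2 fun j => ?_
    by_cases h : j = i
    · subst h; simpa using measurable_snd
    · simpa [Function.update_of_ne h, Function.comp_def] using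
        (measurable_pi_apply (X := fun _ : Fin d => ℝ) j).comp
          (measurable_fst (β := ℝ))
  have key : MeasurePreserving (fun z : (Fin d → ℝ) × ℝ => Function.update z.1 i z.2)
      ((Measure.pi fun _ : Fin d => unifInterval α).prod (unifInterval α))
      (Measure.pi fun _ : Fin d => unifInterval α) := by
    refine ⟨hupd, (Measure.pi_eq fun s hs => ?_).symm⟩
    rw [Measure.map_apply hupd (MeasurableSet.univ_pi hs)]
    have hpre : (fun z : (Fin d → ℝ) × ℝ => Function.update z.1 i z.2) ⁻¹' (Set.univ.pi s) =
        (Set.univ.pi (Function.update s i Set.univ)) ×ˢ s i := by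
      ext ⟨z, t⟩
      simp only [Set.mem_preimage, Set.mem_pi, Set.mem_univ, true_imp_iff, Set.mem_prod]
      constructor
      · refine fun h => ⟨fun j => ?_, by simpa using h i⟩
        by_cases hj : j = i
        · subst hj; simp
        · simpa [Function.update_of_ne hj] using h j
      · rintro ⟨h1, h2⟩ j
        by_cases hj : j = i
        · subst hj; simpa using h2
        · simpa [Function.update_of_ne hj] using h1 j
    rw [hpre, Measure.prod_prod, Measure.pi_pi, ← Finset.mul_prod_erase _ _ (Finset.mem_univ i),
      ← Finset.mul_prod_erase (a := i) _ (fun j => unifInterval α (s j)) (Finset.mem_univ i)]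
    have : ∏ x ∈ Finset.univ.erase i, unifInterval α (Function.update s i Set.univ x) =
        ∏ x ∈ Finset.univ.erase i, unifInterval α (s x) :=
      Finset.prod_congr rfl fun j hj => by
        rw [Function.update_of_ne (Finset.ne_of_mem_erase hj)]
    rw [this]
    simp [mul_comm]
  have hback : MeasurePreserving (WithLp.toLp 2 : (Fin d → ℝ) → Vec d)
      (Measure.pi fun _ : Fin d => unifInterval α) (unifBox d α) := by
    refine ⟨by fun_prop, ?_⟩
    rw [← map_ofLp_unifBox hα, Measure.map_map (by fun_prop) (by fun_prop)]
    exact Measure.map_id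
  exact hback.comp (key.comp ((measurePreserving_ofLp_unifBox hα).prod
    (MeasurePreserving.id (unifInterval α))))

lemma integral_unifInterval (hα : 0 < α) (h : ℝ → ℝ) :
    ∫ s, h s ∂(unifInterval α) = α⁻¹ * ∫ s in (-(α / 2))..(α / 2), h s := by
  rw [unifInterval, ProbabilityTheory.cond, integral_smul_measure, volume_Icc_half,
    intervalIntegral.integral_of_le (by linarith), integral_Icc_eq_integral_Ioc]
  simp [ENNReal.toReal_inv, hα.le]

/-- The second moment of a uniform vector on `[-α / 2, α / 2]^d` is `d α² / 12`. -/
lemma integral_norm_sq_unifBox (hα : 0 < α) :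
    ∫ u, ‖u‖ ^ 2 ∂(unifBox d α) = d * α ^ 2 / 12 := by
  have := isProbabilityMeasure_unifInterval hα
  have hcoord : ∀ i : Fin d, MeasurePreserving (fun u : Vec d => u i) (unifBox d α)
      (unifInterval α) := fun i =>
    (measurePreserving_eval (fun _ : Fin d => unifInterval α) i).comp
      (measurePreserving_ofLp_unifBox hα)
  have hone : ∫ s, s ^ 2 ∂(unifInterval α) = α ^ 2 / 12 := by
    rw [integral_unifInterval hα, integral_pow]
    field_simp
    ring
  have hint : Integrable (fun s : ℝ => s ^ 2) (unifInterval α) := by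
    have hmem : ∀ᵐ s ∂(unifInterval α), s ∈ Set.Icc (-(α / 2)) (α / 2) :=
      ae_cond_mem measurableSet_Icc
    refine Integrable.of_bound (by fun_prop) ((α / 2) ^ 2) ?_
    filter_upwards [hmem] with s hs
    rw [Real.norm_eq_abs, abs_pow]
    exact pow_le_pow_left₀ (abs_nonneg _) (abs_le.2 hs) 2
  simp_rw [EuclideanSpace.norm_sq_eq]
  rw [integral_finsetSum]
  · have : ∀ i : Fin d, ∫ u : Vec d, ‖u i‖ ^ 2 ∂(unifBox d α) = α ^ 2 / 12 := fun i => by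
      rw [← hone, ← (hcoord i).map_eq, integral_map (hcoord i).aemeasurable
        (by rw [(hcoord i).map_eq]; fun_prop)]
      simp
    rw [Finset.sum_congr rfl fun i _ => this i]
    simp only [Finset.sum_const, Finset.card_univ, Fintype.card_fin, nsmul_eq_mul]
    ring
  · intro i _
    have := (hcoord i).integrable_comp_of_integrable hint
    simpa [Function.comp_def] using this

lemma norm_le_sqrt_mul_of_forall_abs_le {x : Vec d} {c : ℝ} (hc : 0 ≤ c) (h : ∀ i, |x i| ≤ c) :
    ‖x‖ ≤ √(d : ℝ) * c := by
  rw [EuclideanSpace.norm_eq, Real.sqrt_le_left (by positivity), mul_pow,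
    Real.sq_sqrt (Nat.cast_nonneg d)]
  calc ∑ i, ‖x i‖ ^ 2 ≤ ∑ _i : Fin d, c ^ 2 := Finset.sum_le_sum fun i _ =>
        pow_le_pow_left₀ (norm_nonneg _) (h i) 2
    _ = d * c ^ 2 := by simp

lemma memLp_norm_unifBox (hα : 0 < α) : MemLp (fun u : Vec d => ‖u‖) 2 (unifBox d α) := by
  have := isProbabilityMeasure_unifBox (d := d) hα
  refine MemLp.of_bound (by fun_prop) (√(d : ℝ) * (α / 2)) ?_
  filter_upwards [ae_mem_box d α] with u hu
  rw [norm_norm]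
  exact norm_le_sqrt_mul_of_forall_abs_le (by positivity) fun i => EReal.coe_le_coe_iff.1 (hu i)

lemma integrable_norm_unifBox (hα : 0 < α) : Integrable (fun u : Vec d => ‖u‖) (unifBox d α) := by
  have := isProbabilityMeasure_unifBox (d := d) hα
  exact (memLp_norm_unifBox hα).integrable one_le_two

/-- The mean norm of a uniform vector, by Jensen's inequality. -/
lemma integral_norm_unifBox_le (hα : 0 < α) :
    ∫ u, ‖u‖ ∂(unifBox d α) ≤ α / 2 * √((d : ℝ) / 3) := by
  have := isProbabilityMeasure_unifBox (d := d) hα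
  have hmem := memLp_norm_unifBox (d := d) hα
  have hvar := variance_nonneg (fun u : Vec d => ‖u‖) (unifBox d α)
  rw [variance_eq_sub hmem] at hvar
  have hsq : (∫ u, ‖u‖ ∂(unifBox d α)) ^ 2 ≤ (α / 2 * √((d : ℝ) / 3)) ^ 2 := by
    rw [mul_pow, Real.sq_sqrt (by positivity)]
    have := integral_norm_sq_unifBox (d := d) hα
    simp only [Pi.pow_apply] at hvar
    linarith
  exact le_of_sq_le_sq hsq (by positivity)

end UniformBox

/-! ### Box smoothing of a Lipschitz function -/

section Smoothing

variable {d : ℕ} {α : ℝ} {g : Vec d → ℝ} {C : NNReal}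

/-- The point `w` with its `i`-th coordinate replaced by `s`. -/
noncomputable def setCoord (w : Vec d) (i : Fin d) (s : ℝ) : Vec d :=
  WithLp.toLp 2 (Function.update (WithLp.ofLp w) i s)

/-- The finite-difference vector of a deterministic function: `finDiff F α w u x` is
`coordDiff α (F · x) w u`. -/
noncomputable def coordDiff (α : ℝ) (g : Vec d → ℝ) (w u : Vec d) : Vec d :=
  WithLp.toLp 2 fun i =>
    g (setCoord (w + u) i (w i + α / 2)) - g (setCoord (w + u) i (w i - α / 2))

lemma finDiff_eq_coordDiff {p : ℕ} (F : Vec d → Vec p → ℝ) (w u : Vec d) (x : Vec p) :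
    finDiff F α w u x = coordDiff α (fun y => F y x) w u := rfl

lemma continuous_setCoord (i : Fin d) : Continuous fun z : Vec d × ℝ => setCoord z.1 i z.2 := by
  unfold setCoord
  refine (PiLp.continuous_toLp 2 _).comp (Continuous.update ?_ i continuous_snd)
  exact (PiLp.continuous_ofLp 2 _).comp continuous_fst

lemma setCoord_sub_setCoord (w : Vec d) (i : Fin d) (s t : ℝ) :
    setCoord w i s - setCoord w i t = EuclideanSpace.single i (s - t) := by
  ext j
  by_cases h : j = i
  · subst h; simp [setCoord]
  · simp [setCoord, h]

lemma norm_setCoord_sub_setCoord (w : Vec d) (i : Fin d) (s t : ℝ) :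
    ‖setCoord w i s - setCoord w i t‖ = |s - t| := by
  rw [setCoord_sub_setCoord]; simp

lemma setCoord_add_sub_setCoord_add (w w' u : Vec d) (i : Fin d) (c : ℝ) :
    setCoord (w + u) i (w i + c) - setCoord (w' + u) i (w' i + c) = w - w' := by
  ext j
  by_cases h : j = i
  · subst h; simp [setCoord]
  · simp [setCoord, h]

lemma abs_sub_le_of_lipschitzWith (hg : LipschitzWith C g) (x y : Vec d) :
    |g x - g y| ≤ C * ‖x - y‖ := by
  simpa [dist_eq_norm] using hg.dist_le_mul x y

lemma abs_coordDiff_le (hα : 0 ≤ α) (hg : LipschitzWith C g) (w u : Vec d) (i : Fin d) :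
    |coordDiff α g w u i| ≤ C * α := by
  refine (abs_sub_le_of_lipschitzWith hg _ _).trans_eq ?_
  rw [norm_setCoord_sub_setCoord]
  congr 1
  rw [show w i + α / 2 - (w i - α / 2) = α by ring, abs_of_nonneg hα]

lemma continuous_coordDiff (hg : Continuous g) (w : Vec d) : Continuous (coordDiff α g w) := by
  unfold coordDiff
  refine (PiLp.continuous_toLp 2 _).comp (continuous_pi fun i => ?_)
  have h : ∀ c : ℝ, Continuous fun u : Vec d => g (setCoord (w + u) i c) := fun c =>
    hg.comp ((continuous_setCoord i).comp
      (f := fun u : Vec d => (w + u, c)) (by fun_prop))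
  exact (h _).sub (h _)

lemma integrable_shift (hα : 0 < α) (hg : LipschitzWith C g) (w : Vec d) :
    Integrable (fun u => g (w + u)) (unifBox d α) := by
  have := isProbabilityMeasure_unifBox (d := d) hα
  have hc := hg.continuous
  refine Integrable.mono' ((integrable_const |g w|).add ((integrable_norm_unifBox hα).const_mul C))
    (by fun_prop) (ae_of_all _ fun u => ?_)
  have h1 := abs_sub_le_of_lipschitzWith hg (w + u) w
  rw [add_sub_cancel_left] at h1
  have h2 := abs_sub_abs_le_abs_sub (g (w + u)) (g w)
  simp only [Pi.add_apply, Real.norm_eq_abs]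
  linarith

lemma abs_smoothed_sub_smoothed_le (hα : 0 < α) (hg : LipschitzWith C g) (w w' : Vec d) :
    |smoothed g α w - smoothed g α w'| ≤ C * ‖w - w'‖ := by
  have := isProbabilityMeasure_unifBox (d := d) hα
  rw [smoothed, smoothed, ← integral_sub (integrable_shift hα hg w) (integrable_shift hα hg w'),
    ← Real.norm_eq_abs]
  refine (norm_integral_le_of_norm_le_const (μ := unifBox d α) (C := C * ‖w - w'‖)
    (ae_of_all _ fun u => ?_)).trans_eq (by rw [probReal_univ, mul_one])
  simpa using abs_sub_le_of_lipschitzWith hg (w + u) (w' + u)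

lemma abs_smoothed_sub_le (hα : 0 < α) (hg : LipschitzWith C g) (w : Vec d) :
    |smoothed g α w - g w| ≤ C * (α / 2 * √((d : ℝ) / 3)) := by
  have := isProbabilityMeasure_unifBox (d := d) hα
  have hconst : g w = ∫ _u, g w ∂(unifBox d α) := by simp
  rw [smoothed, hconst, ← integral_sub (integrable_shift hα hg w) (integrable_const _),
    ← Real.norm_eq_abs]
  refine (norm_integral_le_of_norm_le ((integrable_norm_unifBox hα).const_mul C)
    (ae_of_all _ fun u => ?_)).trans ?_
  · simpa using abs_sub_le_of_lipschitzWith hg (w + u) w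
  · rw [integral_const_mul]
    exact mul_le_mul_of_nonneg_left (integral_norm_unifBox_le hα) C.2

/-- No differentiability is needed: `gradient g w` is `0` where `g` is not differentiable. -/
lemma norm_gradient_le (hg : LipschitzWith C g) (w : Vec d) : ‖gradient g w‖ ≤ C := by
  rw [gradient, LinearIsometryEquiv.norm_map]
  exact norm_fderiv_le_of_lipschitz ℝ hg

lemma measurable_gradient (g : Vec d → ℝ) : Measurable (gradient g) :=
  ((InnerProductSpace.toDual ℝ (Vec d)).symm.continuous.measurable).comp (measurable_fderiv ℝ g)

lemma integrable_gradient_shift (hα : 0 < α) (hg : LipschitzWith C g) (w : Vec d) :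
    Integrable (fun u => gradient g (w + u)) (unifBox d α) := by
  have := isProbabilityMeasure_unifBox (d := d) hα
  refine Integrable.of_bound ?_ C (ae_of_all _ fun u => norm_gradient_le hg _)
  exact ((measurable_gradient g).comp (measurable_const_add w)).aestronglyMeasurable

/-- The smoothed function is differentiable and its gradient is the mean of the almost everywhere
defined gradients (Rademacher's theorem and differentiation under the integral). -/
lemma hasGradientAt_smoothed (hα : 0 < α) (hg : LipschitzWith C g) (w : Vec d) :
    HasGradientAt (smoothed g α) (∫ u, gradient g (w + u) ∂(unifBox d α)) w := by
  have := isProbabilityMeasure_unifBox (d := d) hα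
  have hc := hg.continuous
  have hdiff : ∀ᵐ u ∂(unifBox d α), DifferentiableAt ℝ g (w + u) :=
    ae_shift_of_ae_volume hg.ae_differentiableAt w
  obtain ⟨hint, hder⟩ := hasFDerivAt_integral_of_dominated_loc_of_lip (𝕜 := ℝ)
    (μ := unifBox d α) (F := fun y u => g (y + u)) (x₀ := w) (s := Set.univ)
    (F' := fun u => fderiv ℝ g (w + u)) (bound := fun _ => (C : ℝ)) univ_mem
    (Eventually.of_forall fun y => by fun_prop) (integrable_shift hα hg w)
    (((measurable_fderiv ℝ g).comp (measurable_const_add w)).aestronglyMeasurable)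
    (ae_of_all _ fun u => by
      refine LipschitzOnWith.of_dist_le_mul fun y _ y' _ => ?_
      simpa using hg.dist_le_mul (y + u) (y' + u))
    (integrable_const _)
    (by
      filter_upwards [hdiff] with u hu
      simpa [Function.comp_def] using
        hu.hasFDerivAt.comp w ((hasFDerivAt_id w).add_const u))
  rw [hasGradientAt_iff_hasFDerivAt]
  convert! hder using 1
  ext h
  rw [InnerProductSpace.toDual_apply_apply, ContinuousLinearMap.integral_apply hint,
    real_inner_comm, ← integral_inner (integrable_gradient_shift hα hg w)]
  refine integral_congr_ae (ae_of_all _ fun u => ?_)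
  simp only
  rw [real_inner_comm, ← InnerProductSpace.toDual_apply_apply (𝕜 := ℝ), gradient,
    LinearIsometryEquiv.apply_symm_apply]

lemma integral_smoothed_resample (hα : 0 < α) (hg : LipschitzWith C g) (w : Vec d) (i : Fin d)
    (t : ℝ) :
    Integrable (fun z : Vec d × ℝ => g (setCoord (w + z.1) i (w i + t + z.2)))
      ((unifBox d α).prod (unifInterval α)) ∧
    smoothed g α (w + EuclideanSpace.single i t) =
      ∫ u, ∫ s, g (setCoord (w + u) i (w i + t + s)) ∂(unifInterval α) ∂(unifBox d α) := by
  have := isProbabilityMeasure_unifInterval hα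
  have := isProbabilityMeasure_unifBox (d := d) hα
  have hres := measurePreserving_resample (d := d) hα i
  have hpt : ∀ z : Vec d × ℝ, w + EuclideanSpace.single i t +
      WithLp.toLp 2 (Function.update (WithLp.ofLp z.1) i z.2) =
        setCoord (w + z.1) i (w i + t + z.2) := fun z => by
    ext j
    by_cases h : j = i
    · subst h; simp [setCoord]
    · simp [setCoord, h]
  have hint := hres.integrable_comp_of_integrable
    (integrable_shift hα hg (w + EuclideanSpace.single i t))
  simp only [Function.comp_def, hpt] at hint
  refine ⟨hint, ?_⟩
  have hc := hg.continuous
  rw [← integral_prod _ hint, smoothed]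
  conv_lhs => rw [← hres.map_eq]
  rw [integral_map hres.aemeasurable (by fun_prop)]
  simp only [hpt]

/-- The partial derivatives of the smoothed function are mean difference quotients: averaging over
the `i`-th coordinate first turns the `i`-th derivative into a difference of endpoint values. -/
lemma integral_gradient_apply (hα : 0 < α) (hg : LipschitzWith C g) (w : Vec d) (i : Fin d) :
    (∫ u, gradient g (w + u) ∂(unifBox d α)) i =
      α⁻¹ * ∫ u, coordDiff α g w u i ∂(unifBox d α) := by
  have := isProbabilityMeasure_unifInterval hα
  have := isProbabilityMeasure_unifBox (d := d) hα
  have hc := hg.continuous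
  set G := ∫ u, gradient g (w + u) ∂(unifBox d α) with hG
  have hline : ∀ t : ℝ, EuclideanSpace.single i t = t • (EuclideanSpace.single i 1 : Vec d) := by
    intro t; ext j; by_cases h : j = i <;> simp [h]
  have hcoord : HasDerivAt (fun t : ℝ => smoothed g α (w + EuclideanSpace.single i t)) (G i) 0 := by
    have h1 : HasDerivAt (fun t : ℝ => w + EuclideanSpace.single i t)
        (EuclideanSpace.single i 1 : Vec d) 0 := by
      have h0 := ((hasDerivAt_id (0 : ℝ)).smul_const
        (EuclideanSpace.single i 1 : Vec d)).const_add w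
      rw [one_smul] at h0
      exact h0.congr_of_eventuallyEq (Eventually.of_forall fun t => by
        change w + EuclideanSpace.single i t = w + t • EuclideanSpace.single i 1
        rw [hline t])
    have h2 : HasFDerivAt (smoothed g α) (InnerProductSpace.toDual ℝ (Vec d) G)
        (w + EuclideanSpace.single i (0 : ℝ)) := by
      rw [show w + EuclideanSpace.single i (0 : ℝ) = w by simp]
      exact (hasGradientAt_smoothed hα hg w).hasFDerivAt
    have h3 := h2.comp_hasDerivAt (0 : ℝ) h1
    rw [InnerProductSpace.toDual_apply_apply, EuclideanSpace.inner_single_right] at h3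
    simpa [Function.comp_def] using h3
  have hψ : ∀ (u : Vec d) (c : ℝ), Continuous fun s : ℝ => g (setCoord (w + u) i (c + s)) :=
    fun u c => hc.comp ((continuous_setCoord i).comp (f := fun s : ℝ => (w + u, c + s))
      (by fun_prop))
  have hlip : ∀ (u : Vec d) (s t t' : ℝ),
      |g (setCoord (w + u) i (w i + t + s)) - g (setCoord (w + u) i (w i + t' + s))| ≤
        C * |t - t'| := fun u s t t' => by
    refine (abs_sub_le_of_lipschitzWith hg _ _).trans_eq ?_
    rw [norm_setCoord_sub_setCoord]; ring_nf
  have hIcc : ∀ (u : Vec d) (t : ℝ), Integrable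
      (fun s => g (setCoord (w + u) i (w i + t + s))) (unifInterval α) := fun u t =>
    ((hψ u (w i + t)).continuousOn.integrableOn_compact isCompact_Icc).smul_measure (by
      rw [volume_Icc_half]; simpa using hα)
  have hpoint : ∀ u : Vec d, HasDerivAt
      (fun t => ∫ s, g (setCoord (w + u) i (w i + t + s)) ∂(unifInterval α))
      (α⁻¹ * coordDiff α g w u i) 0 := by
    intro u
    have hcont : Continuous fun s : ℝ => g (setCoord (w + u) i s) := by simpa using hψ u 0
    -- The mean over `s` is an integral of `g` over a window of length `α` sliding with `t`.
    have hFTC : ∀ c : ℝ, HasDerivAt (fun t => ∫ s in (0 : ℝ)..(c + t), g (setCoord (w + u) i s))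
        (g (setCoord (w + u) i c)) 0 := fun c => by
      have h1 : HasDerivAt (fun b => ∫ s in (0 : ℝ)..b, g (setCoord (w + u) i s))
          (g (setCoord (w + u) i (c + 0))) (c + 0) :=
        intervalIntegral.integral_hasDerivAt_right (hcont.intervalIntegrable _ _)
          (hcont.stronglyMeasurableAtFilter _ _) hcont.continuousAt
      have h2 := h1.comp (0 : ℝ) ((hasDerivAt_id (0 : ℝ)).const_add c)
      simpa [Function.comp_def] using h2
    have hsub := ((hFTC (w i + α / 2)).sub (hFTC (w i - α / 2))).const_mul α⁻¹
    refine (hsub.congr_of_eventuallyEq (Eventually.of_forall fun t => ?_))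
    simp only [Pi.sub_apply]
    rw [integral_unifInterval hα, intervalIntegral.integral_interval_sub_left
      (hcont.intervalIntegrable _ _) (hcont.intervalIntegrable _ _),
      intervalIntegral.integral_comp_add_left (fun s => g (setCoord (w + u) i s))]
    ring_nf
  have hmeas : ∀ t : ℝ, AEStronglyMeasurable
      (fun u => ∫ s, g (setCoord (w + u) i (w i + t + s)) ∂(unifInterval α)) (unifBox d α) :=
    fun t => (integral_smoothed_resample hα hg w i t).1.integral_prod_left.aestronglyMeasurable
  obtain ⟨-, hder⟩ := hasDerivAt_integral_of_dominated_loc_of_lip (𝕜 := ℝ)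
    (μ := unifBox d α)
    (F := fun t u => ∫ s, g (setCoord (w + u) i (w i + t + s)) ∂(unifInterval α)) (x₀ := 0)
    (s := Set.univ) (F' := fun u => α⁻¹ * coordDiff α g w u i) (bound := fun _ => (C : ℝ)) univ_mem
    (Eventually.of_forall hmeas)
    (integral_smoothed_resample hα hg w i 0).1.integral_prod_left
    ((((EuclideanSpace.proj (𝕜 := ℝ) i).continuous.comp
      (continuous_coordDiff (α := α) hc w)).const_smul α⁻¹).aestronglyMeasurable)
    (ae_of_all _ fun u => by
      refine LipschitzOnWith.of_dist_le_mul fun t _ t' _ => ?_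
      rw [dist_eq_norm, ← integral_sub (hIcc u t) (hIcc u t')]
      refine (norm_integral_le_of_norm_le_const (C := C * |t - t'|)
        (ae_of_all _ fun s => hlip u s t t')).trans_eq ?_
      simp [Real.dist_eq])
    (integrable_const _) (ae_of_all _ hpoint)
  rw [integral_const_mul] at hder
  refine hcoord.unique (hder.congr_of_eventuallyEq (Eventually.of_forall fun t => ?_))
  exact (integral_smoothed_resample hα hg w i t).2

lemma integrable_coordDiff (hα : 0 < α) (hg : LipschitzWith C g) (w : Vec d) :
    Integrable (coordDiff α g w) (unifBox d α) := by
  have := isProbabilityMeasure_unifBox (d := d) hα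
  exact Integrable.of_bound (continuous_coordDiff hg.continuous w).aestronglyMeasurable
    (√(d : ℝ) * (C * α)) (ae_of_all _ fun u =>
      norm_le_sqrt_mul_of_forall_abs_le (by positivity) (abs_coordDiff_le hα.le hg w u))

lemma integral_vec_apply {X : Type*} [MeasurableSpace X] {μ : Measure X} {h : X → Vec d}
    (hh : Integrable h μ) (i : Fin d) : (∫ x, h x ∂μ) i = ∫ x, h x i ∂μ :=
  ((EuclideanSpace.proj (𝕜 := ℝ) i).integral_comp_comm hh).symm

lemma integral_gradient_eq (hα : 0 < α) (hg : LipschitzWith C g) (w : Vec d) :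
    ∫ u, gradient g (w + u) ∂(unifBox d α) = ∫ u, α⁻¹ • coordDiff α g w u ∂(unifBox d α) := by
  ext i
  rw [integral_gradient_apply hα hg, integral_smul, PiLp.smul_apply,
    integral_vec_apply (integrable_coordDiff hα hg w), smul_eq_mul]

lemma gradient_smoothed_eq (hα : 0 < α) (hg : LipschitzWith C g) (w : Vec d) :
    gradient (smoothed g α) w = ∫ u, α⁻¹ • coordDiff α g w u ∂(unifBox d α) := by
  rw [(hasGradientAt_smoothed hα hg w).gradient, integral_gradient_eq hα hg]

/-- The gradient of the smoothed function is Lipschitz: each mean difference quotient involves two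
values of `g`, and both evaluation points move by exactly `w - w'`. -/
lemma norm_gradient_smoothed_sub_le (hα : 0 < α) (hg : LipschitzWith C g) (w w' : Vec d) :
    ‖gradient (smoothed g α) w - gradient (smoothed g α) w'‖ ≤
      2 * α⁻¹ * √(d : ℝ) * C * ‖w - w'‖ := by
  have := isProbabilityMeasure_unifBox (d := d) hα
  have hi : ∀ y, Integrable (fun u => α⁻¹ • coordDiff α g y u) (unifBox d α) :=
    fun y => (integrable_coordDiff hα hg y).smul (α⁻¹)
  rw [gradient_smoothed_eq hα hg, gradient_smoothed_eq hα hg, ← integral_sub (hi w) (hi w')]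
  refine (norm_integral_le_of_norm_le_const (C := 2 * α⁻¹ * √(d : ℝ) * C * ‖w - w'‖)
    (ae_of_all _ fun u => ?_)).trans_eq (by simp)
  rw [← smul_sub, norm_smul, Real.norm_of_nonneg (by positivity)]
  have h : ‖coordDiff α g w u - coordDiff α g w' u‖ ≤ √(d : ℝ) * (2 * (C * ‖w - w'‖)) := by
    refine norm_le_sqrt_mul_of_forall_abs_le (by positivity) fun i => ?_
    have h1 := abs_sub_le_of_lipschitzWith hg (setCoord (w + u) i (w i + α / 2))
      (setCoord (w' + u) i (w' i + α / 2))
    have h2 := abs_sub_le_of_lipschitzWith hg (setCoord (w + u) i (w i + -(α / 2)))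
      (setCoord (w' + u) i (w' i + -(α / 2)))
    rw [setCoord_add_sub_setCoord_add] at h1 h2
    simp only [coordDiff, PiLp.sub_apply, sub_eq_add_neg (_ : ℝ) (α / 2)]
    rw [abs_le] at h1 h2 ⊢
    constructor <;> linarith [h1.1, h1.2, h2.1, h2.2]
  calc α⁻¹ * ‖coordDiff α g w u - coordDiff α g w' u‖
      ≤ α⁻¹ * (√(d : ℝ) * (2 * (C * ‖w - w'‖))) := by gcongr
    _ = 2 * α⁻¹ * √(d : ℝ) * C * ‖w - w'‖ := by ring

end Smoothing

/-! ### Normal cones and the stationarity distance -/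

section NormalCone

variable {d : ℕ} {A : Set (Vec d)}

/-- The residual of a projection is a proximal normal, hence a Fréchet normal. -/
lemma smul_sub_mem_frechetNormalCone {x y : Vec d} (hy : y ∈ proj A x) {c : ℝ} (hc : 0 ≤ c) :
    c • (x - y) ∈ frechetNormalCone y A := by
  refine ⟨hy.1, ?_⟩
  have hbound : ∀ᶠ z in 𝓝[A \ {y}] y,
      ((inner ℝ (c • (x - y)) (z - y) / ‖z - y‖ : ℝ) : EReal) ≤
        ((c / 2 * ‖z - y‖ : ℝ) : EReal) := by
    filter_upwards [self_mem_nhdsWithin] with z hz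
    have hpos : 0 < ‖z - y‖ := norm_pos_iff.2 (sub_ne_zero.2 hz.2)
    rw [EReal.coe_le_coe_iff, div_le_iff₀ hpos, real_inner_smul_left]
    have h1 : ‖y - x‖ ^ 2 ≤ ‖z - x‖ ^ 2 := pow_le_pow_left₀ (norm_nonneg _) (hy.2 z hz.1) 2
    have h2 : z - x = (z - y) - (x - y) := by abel
    rw [h2, norm_sub_sq_real (z - y), norm_sub_rev y x, real_inner_comm] at h1
    have h3 : inner ℝ (x - y) (z - y) ≤ ‖z - y‖ ^ 2 / 2 := by linarith
    calc c * inner ℝ (x - y) (z - y) ≤ c * (‖z - y‖ ^ 2 / 2) := by gcongr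
      _ = c / 2 * ‖z - y‖ * ‖z - y‖ := by ring
  have hlim : Tendsto (fun z : Vec d => ((c / 2 * ‖z - y‖ : ℝ) : EReal)) (𝓝[A \ {y}] y)
      (𝓝 ((0 : ℝ) : EReal)) := by
    refine (continuous_coe_real_ereal.tendsto 0).comp ?_
    have : Tendsto (fun z : Vec d => c / 2 * ‖z - y‖) (𝓝 y) (𝓝 (c / 2 * ‖y - y‖)) :=
      Continuous.tendsto (by fun_prop) y
    simpa using this.mono_left nhdsWithin_le_nhds
  rcases eq_or_neBot (𝓝[A \ {y}] y) with h | h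
  · rw [h, limsup_bot]; exact bot_le
  · exact (limsup_le_limsup hbound).trans_eq (hlim.limsup_eq.trans EReal.coe_zero)

lemma frechetNormalCone_subset_mordukhovichNormalCone (x : Vec d) :
    frechetNormalCone x A ⊆ mordukhovichNormalCone x A := fun v hv =>
  ⟨hv.1, fun _ => x, fun _ => v, fun _ => hv.1, tendsto_const_nhds, fun _ => hv,
    tendsto_const_nhds⟩

/-- For a closed set the graph of the limiting normal cone is the closure of the graph of the
Fréchet normal cone. -/
lemma mem_mordukhovichNormalCone_iff (hA : IsClosed A) {x v : Vec d} :
    v ∈ mordukhovichNormalCone x A ↔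
      (x, v) ∈ closure {z : Vec d × Vec d | z.2 ∈ frechetNormalCone z.1 A} := by
  rw [mem_closure_iff_seq_limit]
  constructor
  · rintro ⟨-, y, n, -, hyx, hn, hnv⟩
    exact ⟨fun k => (y k, n k), hn, hyx.prodMk_nhds hnv⟩
  · rintro ⟨z, hz, hlim⟩
    rw [nhds_prod_eq] at hlim
    have h1 : Tendsto (fun k => (z k).1) atTop (𝓝 x) := hlim.fst
    have h2 : Tendsto (fun k => (z k).2) atTop (𝓝 v) := hlim.snd
    exact ⟨hA.mem_of_tendsto h1 (Eventually.of_forall fun k => (hz k).1),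
      fun k => (z k).1, fun k => (z k).2, fun k => (hz k).1, h1, hz, h2⟩

/-- The stationarity distance is lower semicontinuous on the whole space: it is infinite off the
closed set `A`, and on `A` the limiting normal cone has a closed graph. -/
lemma isClosed_statDist_le {g : Vec d → ℝ} (hA : IsClosed A)
    (hg : ContinuousOn (gradient g) A) (c : ℝ≥0∞) : IsClosed {x | statDist g A x ≤ c} := by
  rcases eq_or_ne c ⊤ with rfl | hc
  · simp
  refine IsSeqClosed.isClosed fun x x₀ hx hlim => ?_
  have hex : ∀ k : ℕ, ∃ v ∈ mordukhovichNormalCone (x k) A,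
      edist 0 (gradient g (x k) + v) < c + ((k : ℝ≥0∞) + 1)⁻¹ := fun k => by
    have hlt : statDist g A (x k) < c + ((k : ℝ≥0∞) + 1)⁻¹ :=
      (hx k).trans_lt (ENNReal.lt_add_right hc (by simp))
    rw [statDist, Metric.infEDist_lt_iff] at hlt
    obtain ⟨_, ⟨v, hv, rfl⟩, h⟩ := hlt
    exact ⟨v, hv, h⟩
  choose v hv hdist using hex
  have hxA : ∀ k, x k ∈ A := fun k => (hv k).1
  have hx₀A : x₀ ∈ A := hA.mem_of_tendsto hlim (Eventually.of_forall hxA)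
  have hgrad : Tendsto (fun k => gradient g (x k)) atTop (𝓝 (gradient g x₀)) :=
    (hg x₀ hx₀A).tendsto.comp (tendsto_nhdsWithin_iff.2 ⟨hlim, Eventually.of_forall hxA⟩)
  have hbdd : ∀ k, gradient g (x k) + v k ∈ Metric.closedBall (0 : Vec d) (c + 1).toReal := by
    intro k
    rw [Metric.mem_closedBall, dist_comm, ← ENNReal.ofReal_le_ofReal_iff ENNReal.toReal_nonneg,
      ← edist_dist, ENNReal.ofReal_toReal (by simp [hc])]
    refine (hdist k).le.trans (add_le_add le_rfl ?_)
    exact ENNReal.inv_le_one.2 (by simp)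
  obtain ⟨z, -, φ, hφ, hz⟩ := tendsto_subseq_of_bounded Metric.isBounded_closedBall hbdd
  have hvlim : Tendsto (fun k => v (φ k)) atTop (𝓝 (z - gradient g x₀)) := by
    simpa [Function.comp_def] using hz.sub (hgrad.comp hφ.tendsto_atTop)
  have hmem : z - gradient g x₀ ∈ mordukhovichNormalCone x₀ A := by
    rw [mem_mordukhovichNormalCone_iff hA]
    refine isClosed_closure.mem_of_tendsto ((hlim.comp hφ.tendsto_atTop).prodMk_nhds hvlim)
      (Eventually.of_forall fun k => ?_)
    exact (mem_mordukhovichNormalCone_iff hA).1 (hv (φ k))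
  have hle : edist 0 z ≤ c := by
    have h1 : Tendsto (fun k => edist 0 (gradient g (x (φ k)) + v (φ k))) atTop (𝓝 (edist 0 z)) :=
      tendsto_const_nhds.edist hz
    have h2 : Tendsto (fun k : ℕ => c + ((φ k : ℝ≥0∞) + 1)⁻¹) atTop (𝓝 (c + 0)) := by
      have h3 : Tendsto (fun k : ℕ => ((k : ℝ≥0∞) + 1)⁻¹) atTop (𝓝 0) := by
        simpa using (tendsto_add_atTop_iff_nat (f := fun n : ℕ => (n : ℝ≥0∞)⁻¹) 1).2
          ENNReal.tendsto_inv_nat_nhds_zero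
      exact (h3.comp hφ.tendsto_atTop).const_add c
    rw [add_zero] at h2
    exact le_of_tendsto_of_tendsto' h1 h2 fun k => (hdist (φ k)).le
  refine le_trans (Metric.infEDist_le_edist_of_mem ?_) hle
  exact ⟨z - gradient g x₀, hmem, by simp⟩

lemma measurable_statDist {g : Vec d → ℝ} (hA : IsClosed A)
    (hg : ContinuousOn (gradient g) A) : Measurable (statDist g A) :=
  measurable_of_Iic fun c => (isClosed_statDist_le hA hg c).measurableSet

end NormalCone

/-! ### One step of the projected method -/

section Descent

variable {d : ℕ} {A : Set (Vec d)} {g : Vec d → ℝ} {ℓ : ℝ}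

/-- The two-sided descent lemma for a function with `ℓ`-Lipschitz gradient. -/
lemma abs_sub_sub_inner_gradient_le (hg : Differentiable ℝ g)
    (hℓ : ∀ x y, ‖gradient g x - gradient g y‖ ≤ ℓ * ‖x - y‖) (x y : Vec d) :
    |g y - g x - inner ℝ (gradient g x) (y - x)| ≤ ℓ / 2 * ‖y - x‖ ^ 2 := by
  have hline : ∀ t : ℝ, HasDerivAt (fun t : ℝ => g (x + t • (y - x)))
      (inner ℝ (gradient g (x + t • (y - x))) (y - x)) t := fun t => by
    have h1 : HasDerivAt (fun t : ℝ => x + t • (y - x)) (y - x) t := by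
      simpa using ((hasDerivAt_id t).smul_const (y - x)).const_add x
    have h2 := (hg (x + t • (y - x))).hasGradientAt.hasFDerivAt.comp_hasDerivAt t h1
    simpa [Function.comp_def] using h2
  have hψ : ∀ t : ℝ, HasDerivAt
      (fun t : ℝ => g (x + t • (y - x)) - g x - t * inner ℝ (gradient g x) (y - x))
      (inner ℝ (gradient g (x + t • (y - x))) (y - x) - inner ℝ (gradient g x) (y - x)) t :=
    fun t => by
      have h := ((hline t).sub_const (g x)).sub
        ((hasDerivAt_id t).mul_const (inner ℝ (gradient g x) (y - x)))
      rw [one_mul] at h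
      exact h
  have hB : ∀ t : ℝ, HasDerivAt (fun t : ℝ => ℓ / 2 * ‖y - x‖ ^ 2 * t ^ 2)
      (ℓ * ‖y - x‖ ^ 2 * t) t := fun t => by
    have := (hasDerivAt_pow 2 t).const_mul (ℓ / 2 * ‖y - x‖ ^ 2)
    convert! this using 1
    push_cast; ring
  have key := image_norm_le_of_norm_deriv_right_le_deriv_boundary
    (f := fun t : ℝ => g (x + t • (y - x)) - g x - t * inner ℝ (gradient g x) (y - x))
    (a := 0) (b := 1) (fun t _ => (hψ t).continuousAt.continuousWithinAt)
    (fun t _ => (hψ t).hasDerivWithinAt) (B := fun t : ℝ => ℓ / 2 * ‖y - x‖ ^ 2 * t ^ 2)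
    (by simp) hB
    (fun t ht => by
      rw [← inner_sub_left]
      refine (norm_inner_le_norm _ _).trans ?_
      have h := hℓ (x + t • (y - x)) x
      rw [add_sub_cancel_left, norm_smul, Real.norm_of_nonneg ht.1] at h
      calc _ ≤ ℓ * (t * ‖y - x‖) * ‖y - x‖ := by gcongr
        _ = ℓ * ‖y - x‖ ^ 2 * t := by ring)
  simpa using key (Set.right_mem_Icc.2 zero_le_one)

lemma sq_norm_sub_le_of_mem_proj {x y G : Vec d} {η : ℝ} (hx : x ∈ A)
    (hy : y ∈ proj A (x - η • G)) :
    ‖y - x‖ ^ 2 + 2 * η * inner ℝ G (y - x) ≤ 0 := by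
  have h1 : ‖y - (x - η • G)‖ ^ 2 ≤ ‖x - (x - η • G)‖ ^ 2 :=
    pow_le_pow_left₀ (norm_nonneg _) (hy.2 x hx) 2
  rw [show y - (x - η • G) = (y - x) + η • G by abel, show x - (x - η • G) = η • G by abel,
    norm_add_sq_real, real_inner_smul_right, real_inner_comm] at h1
  linarith

lemma norm_sub_le_of_mem_proj {x y G : Vec d} {η : ℝ} (hη : 0 ≤ η) (hx : x ∈ A)
    (hy : y ∈ proj A (x - η • G)) : ‖y - x‖ ≤ 2 * η * ‖G‖ := by
  have h1 := hy.2 x hx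
  rw [show x - (x - η • G) = η • G by abel, norm_smul, Real.norm_of_nonneg hη] at h1
  have h2 : ‖y - x‖ ≤ ‖y - (x - η • G)‖ + ‖η • G‖ := by
    rw [show y - x = (y - (x - η • G)) - η • G by abel]
    exact norm_sub_le _ _
  rw [norm_smul, Real.norm_of_nonneg hη] at h2
  linarith

/-- Sufficient decrease along a projected step with inexact gradient `G` and
`η = 2 / (3 ρ ℓ)`; the error term is split by Young's inequality with weight `ℓ / 2`. -/
lemma descent_step (hg : Differentiable ℝ g) (hℓpos : 0 < ℓ)
    (hℓ : ∀ x y, ‖gradient g x - gradient g y‖ ≤ ℓ * ‖x - y‖) {ρ η : ℝ} (hρ : 0 < ρ)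
    (hη : η = 2 / (3 * ρ * ℓ)) {x y G : Vec d} (hx : x ∈ A) (hy : y ∈ proj A (x - η • G)) :
    3 / 4 * ℓ * (ρ - 1) * ‖y - x‖ ^ 2 ≤ g x - g y + ‖G - gradient g x‖ ^ 2 / ℓ := by
  have h1 := (abs_le.1 (abs_sub_sub_inner_gradient_le hg hℓ x y)).2
  have h2 := sq_norm_sub_le_of_mem_proj hx hy
  have h3 : inner ℝ (gradient g x) (y - x) =
      inner ℝ G (y - x) - inner ℝ (G - gradient g x) (y - x) := by
    rw [inner_sub_left]; ring
  have h4 := neg_abs_le (inner ℝ (G - gradient g x) (y - x))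
  have h5 := abs_real_inner_le_norm (G - gradient g x) (y - x)
  have h6 : ‖G - gradient g x‖ * ‖y - x‖ ≤ ℓ / 4 * ‖y - x‖ ^ 2 + ‖G - gradient g x‖ ^ 2 / ℓ := by
    have h : 0 ≤ (ℓ / 2 * ‖y - x‖ - ‖G - gradient g x‖) ^ 2 / ℓ := by positivity
    have h' : (ℓ / 2 * ‖y - x‖ - ‖G - gradient g x‖) ^ 2 / ℓ =
        ℓ / 4 * ‖y - x‖ ^ 2 + ‖G - gradient g x‖ ^ 2 / ℓ - ‖G - gradient g x‖ * ‖y - x‖ := by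
      field_simp; ring
    linarith
  have h7 : inner ℝ G (y - x) ≤ -(3 * ρ * ℓ / 4 * ‖y - x‖ ^ 2) := by
    have : 2 * η = 4 / (3 * ρ * ℓ) := by rw [hη]; ring
    rw [this] at h2
    have h8 : ‖y - x‖ ^ 2 + 4 / (3 * ρ * ℓ) * inner ℝ G (y - x) =
        4 / (3 * ρ * ℓ) * (3 * ρ * ℓ / 4 * ‖y - x‖ ^ 2 + inner ℝ G (y - x)) := by
      field_simp
    rw [h8] at h2
    have := nonpos_of_mul_nonpos_right h2 (by positivity)
    linarith
  nlinarith

lemma statDist_le_of_mem {y n : Vec d} (hn : n ∈ mordukhovichNormalCone y A) :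
    statDist g A y ^ 2 ≤ ENNReal.ofReal (‖gradient g y + n‖ ^ 2) := by
  rw [ENNReal.ofReal_pow (norm_nonneg _), ← dist_zero_left, ← edist_dist]
  exact pow_le_pow_left' (Metric.infEDist_le_edist_of_mem (Set.mem_image_of_mem _ hn)) 2

/-- Approximate stationarity after a projected step. The normal vector is the scaled projection
residual; its contribution is controlled by the decrease of `g` through the projection
inequality. -/
lemma exists_norm_gradient_add_normal_sq_le (hg : Differentiable ℝ g) (hℓpos : 0 < ℓ)
    (hℓ : ∀ x y, ‖gradient g x - gradient g y‖ ≤ ℓ * ‖x - y‖) {ρ η : ℝ} (hρ : 0 < ρ)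
    (hη : η = 2 / (3 * ρ * ℓ)) {x y G : Vec d} (hx : x ∈ A) (hy : y ∈ proj A (x - η • G)) :
    ∃ n ∈ mordukhovichNormalCone y A, ‖gradient g y + n‖ ^ 2 ≤ 3 * ρ * ℓ * (g x - g y) +
      3 * ‖G - gradient g x‖ ^ 2 + 3 / 2 * ℓ ^ 2 * (1 + ρ) * ‖y - x‖ ^ 2 := by
  have hηpos : 0 < η := by rw [hη]; positivity
  have hinv : η⁻¹ = 3 * ρ * ℓ / 2 := by rw [hη, inv_div]
  set n : Vec d := η⁻¹ • ((x - η • G) - y) with hn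
  have hmem : n ∈ mordukhovichNormalCone y A :=
    frechetNormalCone_subset_mordukhovichNormalCone y
      (smul_sub_mem_frechetNormalCone hy (inv_nonneg.2 hηpos.le))
  have hn' : gradient g y + n = (gradient g y - G) - η⁻¹ • (y - x) := by
    rw [hn, smul_sub, smul_sub, smul_sub, smul_smul, inv_mul_cancel₀ hηpos.ne', one_smul]
    abel
  refine ⟨n, hmem, ?_⟩
  rw [hn', norm_sub_sq_real, real_inner_smul_right, norm_smul, Real.norm_of_nonneg (by positivity),
    mul_pow, inner_sub_left]
  have h1 := (abs_le.1 (abs_sub_sub_inner_gradient_le hg hℓ y x)).1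
  have h2 : ‖y - x‖ ^ 2 * η⁻¹ ^ 2 ≤ -(2 * η⁻¹ * inner ℝ G (y - x)) := by
    have h := mul_le_mul_of_nonneg_left (sq_norm_sub_le_of_mem_proj hx hy) (sq_nonneg η⁻¹)
    have h' : η⁻¹ ^ 2 * (‖y - x‖ ^ 2 + 2 * η * inner ℝ G (y - x)) =
        ‖y - x‖ ^ 2 * η⁻¹ ^ 2 + 2 * η⁻¹ * inner ℝ G (y - x) := by field_simp
    linarith
  -- `(a + b)² ≤ 3 / 2 * a² + 3 * b²`; the weight `3` on the gradient error is the one in `constC2`.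
  have h3 : ‖gradient g y - G‖ ^ 2 ≤
      3 / 2 * ℓ ^ 2 * ‖y - x‖ ^ 2 + 3 * ‖G - gradient g x‖ ^ 2 := by
    have ha : ‖gradient g y - G‖ ≤ ℓ * ‖y - x‖ + ‖G - gradient g x‖ := by
      rw [show gradient g y - G = (gradient g y - gradient g x) - (G - gradient g x) by abel]
      exact (norm_sub_le _ _).trans (add_le_add_left (hℓ y x) _)
    have hb := pow_le_pow_left₀ (norm_nonneg _) ha 2
    nlinarith [sq_nonneg (ℓ * ‖y - x‖ - 2 * ‖G - gradient g x‖)]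
  have h4 : inner ℝ (gradient g y) (x - y) = -inner ℝ (gradient g y) (y - x) := by
    rw [← inner_neg_right, neg_sub]
  rw [h4, norm_sub_rev x y] at h1
  have h5 : -(2 * η⁻¹ * inner ℝ (gradient g y) (y - x)) ≤
      2 * η⁻¹ * (g x - g y + ℓ / 2 * ‖y - x‖ ^ 2) := by
    have : -inner ℝ (gradient g y) (y - x) ≤ g x - g y + ℓ / 2 * ‖y - x‖ ^ 2 := by linarith
    calc _ = 2 * η⁻¹ * -inner ℝ (gradient g y) (y - x) := by ring
      _ ≤ _ := by gcongr
  rw [hinv] at h2 h5 ⊢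
  linarith

lemma sum_Icc_sub_succ (f : ℕ → ℝ) (K : ℕ) :
    ∑ k ∈ Finset.Icc 1 K, (f k - f (k + 1)) = f 1 - f (K + 1) := by
  induction K with
  | zero => simp
  | succ K ih => rw [Finset.sum_Icc_succ_top (by omega), ih]; ring

/-- The pathwise bound for a whole run. The weight `τ` adds `3 / 4 * ℓ * τ` times the squared
displacement to the sufficient-decrease inequality on both sides, the added right-hand side being
bounded through `‖y - x‖ ≤ 2 η ‖G‖`; this makes the left-hand coefficient positive even when
`ρ ≤ 1`. -/
lemma sum_statDist_sq_le (hg : Differentiable ℝ g) (hℓpos : 0 < ℓ)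
    (hℓ : ∀ x y, ‖gradient g x - gradient g y‖ ≤ ℓ * ‖x - y‖) {ρ τ η : ℝ} (hρ : 0 < ρ)
    (hτ : 0 ≤ τ) (hρτ : 1 < ρ + τ) (hη : η = 2 / (3 * ρ * ℓ)) {K : ℕ} {x G : ℕ → Vec d}
    (hx : ∀ k ∈ Finset.Icc 1 K, x k ∈ A)
    (hstep : ∀ k ∈ Finset.Icc 1 K, x (k + 1) ∈ proj A (x k - η • G k)) {Δ : ℝ} (hΔ : 0 ≤ Δ)
    (hgap : g (x 1) - g (x (K + 1)) ≤ Δ) :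
    ∑ k ∈ Finset.Icc 1 K, statDist g A (x (k + 1)) ^ 2 ≤
      ENNReal.ofReal (constC1 ρ τ * (ℓ * Δ)) +
        ∑ k ∈ Finset.Icc 1 K,
          (ENNReal.ofReal (3 + 2 * (1 + 3 * ρ) / (τ + ρ - 1)) *
              ENNReal.ofReal (‖G k - gradient g (x k)‖ ^ 2) +
            ENNReal.ofReal (2 * (1 + 3 * ρ) / (τ + ρ - 1) * (4 / 3 * (τ / ρ ^ 2))) *
              ENNReal.ofReal (‖G k‖ ^ 2)) := by
  have hT : 0 < τ + ρ - 1 := by linarith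
  have hηnn : 0 ≤ η := by rw [hη]; positivity
  choose! n hn hnle using fun k (hk : k ∈ Finset.Icc 1 K) =>
    exists_norm_gradient_add_normal_sq_le hg hℓpos hℓ hρ hη (hx k hk) (hstep k hk)
  set D := ∑ k ∈ Finset.Icc 1 K, ‖G k - gradient g (x k)‖ ^ 2 with hD
  set N := ∑ k ∈ Finset.Icc 1 K, ‖G k‖ ^ 2 with hN
  set V := ∑ k ∈ Finset.Icc 1 K, ‖x (k + 1) - x k‖ ^ 2 with hV
  have hDnn : 0 ≤ D := Finset.sum_nonneg fun _ _ => sq_nonneg _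
  have hNnn : 0 ≤ N := Finset.sum_nonneg fun _ _ => sq_nonneg _
  have hVnn : 0 ≤ V := Finset.sum_nonneg fun _ _ => sq_nonneg _
  have htel := sum_Icc_sub_succ (fun k => g (x k)) K
  have h1 : 3 / 4 * ℓ * (ρ - 1) * V ≤ Δ + D / ℓ := by
    have := Finset.sum_le_sum fun k (hk : k ∈ Finset.Icc 1 K) =>
      descent_step hg hℓpos hℓ hρ hη (hx k hk) (hstep k hk)
    rw [← Finset.mul_sum, Finset.sum_add_distrib, htel, ← Finset.sum_div] at this
    linarith
  have h2 : V ≤ 4 * η ^ 2 * N := by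
    rw [hV, hN, Finset.mul_sum]
    refine Finset.sum_le_sum fun k hk => ?_
    have := pow_le_pow_left₀ (norm_nonneg _)
      (norm_sub_le_of_mem_proj hηnn (hx k hk) (hstep k hk)) 2
    calc _ ≤ _ := this
      _ = _ := by ring
  have h3 : 3 / 4 * ℓ * τ * V ≤ 4 / 3 * (τ / ρ ^ 2) * N / ℓ := by
    calc 3 / 4 * ℓ * τ * V ≤ 3 / 4 * ℓ * τ * (4 * η ^ 2 * N) := by gcongr
      _ = 4 / 3 * (τ / ρ ^ 2) * N / ℓ := by rw [hη]; field_simp; ring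
  have h4 : ∑ k ∈ Finset.Icc 1 K, ‖gradient g (x (k + 1)) + n k‖ ^ 2 ≤
      3 * ρ * ℓ * Δ + 3 * D + 3 / 2 * ℓ ^ 2 * (1 + ρ) * V := by
    refine (Finset.sum_le_sum hnle).trans ?_
    rw [Finset.sum_add_distrib, Finset.sum_add_distrib, ← Finset.mul_sum, ← Finset.mul_sum,
      ← Finset.mul_sum, htel]
    gcongr
  have h5 : 3 / 2 * ℓ ^ 2 * (1 + ρ) * V ≤ 2 * (1 + 3 * ρ) / (τ + ρ - 1) *
      (ℓ * Δ + D + 4 / 3 * (τ / ρ ^ 2) * N) := by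
    have h6 : 3 / 4 * ℓ ^ 2 * (τ + ρ - 1) * V ≤ ℓ * Δ + D + 4 / 3 * (τ / ρ ^ 2) * N := by
      have h7 : 3 / 4 * ℓ * (τ + ρ - 1) * V ≤ Δ + D / ℓ + 4 / 3 * (τ / ρ ^ 2) * N / ℓ := by
        linarith
      calc 3 / 4 * ℓ ^ 2 * (τ + ρ - 1) * V = ℓ * (3 / 4 * ℓ * (τ + ρ - 1) * V) := by ring
        _ ≤ ℓ * (Δ + D / ℓ + 4 / 3 * (τ / ρ ^ 2) * N / ℓ) := by gcongr
        _ = _ := by field_simp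
    -- The constants of the theorem only require the weaker factor `1 + 3 * ρ`.
    calc 3 / 2 * ℓ ^ 2 * (1 + ρ) * V ≤ 3 / 2 * ℓ ^ 2 * (1 + 3 * ρ) * V := by gcongr; linarith
      _ = 2 * (1 + 3 * ρ) / (τ + ρ - 1) * (3 / 4 * ℓ ^ 2 * (τ + ρ - 1) * V) := by
          field_simp; ring
      _ ≤ _ := by gcongr
  calc ∑ k ∈ Finset.Icc 1 K, statDist g A (x (k + 1)) ^ 2
      ≤ ∑ k ∈ Finset.Icc 1 K, ENNReal.ofReal (‖gradient g (x (k + 1)) + n k‖ ^ 2) :=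
        Finset.sum_le_sum fun k hk => statDist_le_of_mem (hn k hk)
    _ = ENNReal.ofReal (∑ k ∈ Finset.Icc 1 K, ‖gradient g (x (k + 1)) + n k‖ ^ 2) :=
        (ENNReal.ofReal_sum_of_nonneg fun _ _ => sq_nonneg _).symm
    _ ≤ ENNReal.ofReal (constC1 ρ τ * (ℓ * Δ) + ((3 + 2 * (1 + 3 * ρ) / (τ + ρ - 1)) * D +
          2 * (1 + 3 * ρ) / (τ + ρ - 1) * (4 / 3 * (τ / ρ ^ 2)) * N)) := by
        refine ENNReal.ofReal_le_ofReal ((h4.trans (add_le_add le_rfl h5)).trans_eq ?_)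
        rw [constC1]; ring
    _ = _ := by
        have hC : 0 ≤ constC1 ρ τ * (ℓ * Δ) := by rw [constC1]; positivity
        have hb : 0 ≤ 3 + 2 * (1 + 3 * ρ) / (τ + ρ - 1) := by positivity
        have hc : 0 ≤ 2 * (1 + 3 * ρ) / (τ + ρ - 1) * (4 / 3 * (τ / ρ ^ 2)) := by positivity
        rw [ENNReal.ofReal_add hC (by positivity), ENNReal.ofReal_add (by positivity)
          (by positivity), ENNReal.ofReal_mul hb, ENNReal.ofReal_mul hc, hD, hN,
          ENNReal.ofReal_sum_of_nonneg fun _ _ => sq_nonneg _,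
          ENNReal.ofReal_sum_of_nonneg fun _ _ => sq_nonneg _, Finset.mul_sum, Finset.mul_sum,
          ← Finset.sum_add_distrib]

end Descent

/-! ### Mini-batch averages -/

section MiniBatch

variable {Z : Type*} [MeasurableSpace Z] {ν : Measure Z} {d M : ℕ}

lemma lintegral_norm_sq_average_le [IsProbabilityMeasure ν] {φ : Z → Vec d}
    (hφ : Measurable φ) {V : ℝ}
    (hV : ∫⁻ z, ENNReal.ofReal (‖φ z‖ ^ 2) ∂ν ≤ ENNReal.ofReal V) (hM : 0 < M) :
    ∫⁻ s, ENNReal.ofReal (‖(1 / (M : ℝ)) • ∑ i, φ (s i)‖ ^ 2) ∂(Measure.pi fun _ : Fin M => ν) ≤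
      ENNReal.ofReal V := by
  have hMpos : (0 : ℝ) < M := by exact_mod_cast hM
  have hpt : ∀ s : Fin M → Z, ENNReal.ofReal (‖(1 / (M : ℝ)) • ∑ i, φ (s i)‖ ^ 2) ≤
      ENNReal.ofReal (1 / M) * ∑ i, ENNReal.ofReal (‖φ (s i)‖ ^ 2) := fun s => by
    rw [← ENNReal.ofReal_sum_of_nonneg fun _ _ => sq_nonneg _, ← ENNReal.ofReal_mul (by positivity)]
    refine ENNReal.ofReal_le_ofReal ?_
    have h1 : ‖∑ i, φ (s i)‖ ^ 2 ≤ M * ∑ i, ‖φ (s i)‖ ^ 2 := by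
      refine (pow_le_pow_left₀ (norm_nonneg _) (norm_sum_le _ _) 2).trans ?_
      simpa using sq_sum_le_card_mul_sum_sq (s := (Finset.univ : Finset (Fin M)))
        (f := fun i => ‖φ (s i)‖)
    rw [norm_smul, mul_pow, Real.norm_of_nonneg (by positivity)]
    calc (1 / (M : ℝ)) ^ 2 * ‖∑ i, φ (s i)‖ ^ 2
        ≤ (1 / (M : ℝ)) ^ 2 * (M * ∑ i, ‖φ (s i)‖ ^ 2) := by gcongr
      _ = 1 / M * ∑ i, ‖φ (s i)‖ ^ 2 := by field_simp
  refine (lintegral_mono hpt).trans ?_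
  have hm : ∀ i : Fin M, Measurable fun s : Fin M → Z => ENNReal.ofReal (‖φ (s i)‖ ^ 2) :=
    fun i => ((hφ.comp (measurable_pi_apply i)).norm.pow_const 2).ennreal_ofReal
  have hone : ∀ i : Fin M,
      ∫⁻ s, ENNReal.ofReal (‖φ (s i)‖ ^ 2) ∂(Measure.pi fun _ : Fin M => ν) =
        ∫⁻ z, ENNReal.ofReal (‖φ z‖ ^ 2) ∂ν := fun i =>
    (measurePreserving_eval (fun _ : Fin M => ν) i).lintegral_comp
      (f := fun z => ENNReal.ofReal (‖φ z‖ ^ 2)) ((hφ.norm.pow_const 2).ennreal_ofReal)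
  rw [lintegral_const_mul _ (Finset.measurable_sum _ fun i _ => hm i),
    lintegral_finsetSum _ fun i _ => hm i, Finset.sum_congr rfl fun i _ => hone i]
  simp only [Finset.sum_const, Finset.card_univ, Fintype.card_fin, nsmul_eq_mul]
  rw [← mul_assoc, ← ENNReal.ofReal_natCast, ← ENNReal.ofReal_mul (by positivity),
    one_div_mul_cancel hMpos.ne', ENNReal.ofReal_one, one_mul]
  exact hV

lemma memLp_two_of_lintegral_le {φ : Z → Vec d} (hφ : Measurable φ) {V : ℝ}
    (hV : ∫⁻ z, ENNReal.ofReal (‖φ z‖ ^ 2) ∂ν ≤ ENNReal.ofReal V) : MemLp φ 2 ν := by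
  refine (memLp_two_iff_integrable_sq_norm hφ.aestronglyMeasurable).2 ⟨by fun_prop, ?_⟩
  rw [hasFiniteIntegral_iff_ofReal (ae_of_all _ fun _ => sq_nonneg _)]
  exact hV.trans_lt ENNReal.ofReal_lt_top

/-- The variance of a mini-batch average is at most the second moment over the batch size. -/
lemma lintegral_norm_sq_average_sub_le [IsProbabilityMeasure ν] {φ : Z → Vec d}
    (hφ : Measurable φ) {V : ℝ} (hV0 : 0 ≤ V)
    (hV : ∫⁻ z, ENNReal.ofReal (‖φ z‖ ^ 2) ∂ν ≤ ENNReal.ofReal V) (hM : 0 < M) :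
    ∫⁻ s, ENNReal.ofReal (‖(1 / (M : ℝ)) • ∑ i, φ (s i) - ∫ z, φ z ∂ν‖ ^ 2)
      ∂(Measure.pi fun _ : Fin M => ν) ≤ ENNReal.ofReal (V / M) := by
  have hMpos : (0 : ℝ) < M := by exact_mod_cast hM
  have hmem := memLp_two_of_lintegral_le hφ hV
  have hint : Integrable φ ν := hmem.integrable one_le_two
  have hcoord : ∀ j : Fin d, MemLp (fun z => φ z j) 2 ν := fun j =>
    hmem.continuousLinearMap_comp (EuclideanSpace.proj (𝕜 := ℝ) j)
  set μ := Measure.pi fun _ : Fin M => ν with hμ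
  have hev : ∀ i : Fin M, MeasurePreserving (fun s : Fin M → Z => s i) μ ν :=
    measurePreserving_eval (fun _ : Fin M => ν)
  have hX : ∀ (j : Fin d) (i : Fin M), MemLp (fun s : Fin M → Z => φ (s i) j) 2 μ := fun j i =>
    (hcoord j).comp_measurePreserving (hev i)
  -- Coordinatewise, the error is centred and the summands are independent.
  have hvar : ∀ j : Fin d,
      ∫ s, ((1 / (M : ℝ)) * ∑ i, φ (s i) j - ∫ z, φ z j ∂ν) ^ 2 ∂μ ≤
        1 / M * ∫ z, φ z j ^ 2 ∂ν := fun j => by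
    have hmean : ∫ s, (1 / (M : ℝ)) * ∑ i, φ (s i) j ∂μ = ∫ z, φ z j ∂ν := by
      rw [integral_const_mul, integral_finsetSum _ fun i _ => (hX j i).integrable one_le_two]
      have : ∀ i : Fin M, ∫ s, φ (s i) j ∂μ = ∫ z, φ z j ∂ν := fun i => by
        rw [← (hev i).map_eq, integral_map (hev i).aemeasurable
          (by rw [(hev i).map_eq]; exact (hcoord j).1)]
      rw [Finset.sum_congr rfl fun i _ => this i]
      simp only [Finset.sum_const, Finset.card_univ, Fintype.card_fin, nsmul_eq_mul]
      field_simp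
    have hsum : MemLp (fun s : Fin M → Z => (1 / (M : ℝ)) * ∑ i, φ (s i) j) 2 μ :=
      (memLp_finsetSum _ fun i _ => hX j i).const_mul _
    have hindep : iIndepFun (fun (i : Fin M) (s : Fin M → Z) => φ (s i) j) μ :=
      iIndepFun_pi (X := fun _ z => φ z j) fun i => (hcoord j).1.aemeasurable
    have h1 : ∫ s, ((1 / (M : ℝ)) * ∑ i, φ (s i) j - ∫ z, φ z j ∂ν) ^ 2 ∂μ =
        Var[fun s => (1 / (M : ℝ)) * ∑ i, φ (s i) j; μ] := by
      rw [variance_eq_integral hsum.1.aemeasurable, hmean]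
    have h2 : Var[∑ i, fun s : Fin M → Z => φ (s i) j; μ] =
        ∑ i, Var[fun s : Fin M → Z => φ (s i) j; μ] :=
      IndepFun.variance_sum (fun i _ => hX j i) fun i _ i' _ h => hindep.indepFun h
    have h3 : ∀ i : Fin M, Var[fun s : Fin M → Z => φ (s i) j; μ] ≤ ∫ z, φ z j ^ 2 ∂ν :=
      fun i => by
        refine (variance_le_expectation_sq (hX j i).1).trans_eq ?_
        rw [← (hev i).map_eq, integral_map (hev i).aemeasurable
          (by rw [(hev i).map_eq]; exact (hcoord j).1.pow 2)]
        rfl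
    rw [h1, variance_const_mul]
    have h4 : (fun s : Fin M → Z => ∑ i, φ (s i) j) = ∑ i, fun s : Fin M → Z => φ (s i) j := by
      ext s; simp
    rw [h4, h2]
    calc (1 / (M : ℝ)) ^ 2 * ∑ i, Var[fun s : Fin M → Z => φ (s i) j; μ]
        ≤ (1 / (M : ℝ)) ^ 2 * ∑ _i : Fin M, ∫ z, φ z j ^ 2 ∂ν := by
          gcongr with i; exact h3 i
      _ = 1 / M * ∫ z, φ z j ^ 2 ∂ν := by
          simp only [Finset.sum_const, Finset.card_univ, Fintype.card_fin, nsmul_eq_mul]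
          field_simp
  have hsqint : ∀ j : Fin d, Integrable
      (fun s => ((1 / (M : ℝ)) * ∑ i, φ (s i) j - ∫ z, φ z j ∂ν) ^ 2) μ := fun j =>
    (((memLp_finsetSum _ fun i _ => hX j i).const_mul _).sub (memLp_const _)).integrable_sq
  have hexp : ∀ s : Fin M → Z, ‖(1 / (M : ℝ)) • ∑ i, φ (s i) - ∫ z, φ z ∂ν‖ ^ 2 =
      ∑ j, ((1 / (M : ℝ)) * ∑ i, φ (s i) j - ∫ z, φ z j ∂ν) ^ 2 := fun s => by
    rw [EuclideanSpace.norm_sq_eq]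
    refine Finset.sum_congr rfl fun j _ => ?_
    rw [Real.norm_eq_abs, sq_abs, PiLp.sub_apply, PiLp.smul_apply, integral_vec_apply hint]
    simp
  have hφsq : ∫ z, ‖φ z‖ ^ 2 ∂ν = ∑ j, ∫ z, φ z j ^ 2 ∂ν := by
    rw [← integral_finsetSum _ fun j _ => (hcoord j).integrable_sq]
    refine integral_congr_ae (ae_of_all _ fun z => ?_)
    simp [EuclideanSpace.norm_sq_eq]
  have hVint : ∫ z, ‖φ z‖ ^ 2 ∂ν ≤ V := by
    rw [← ofReal_integral_eq_lintegral_ofReal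
      ((memLp_two_iff_integrable_sq_norm hφ.aestronglyMeasurable).1 hmem)
      (ae_of_all _ fun _ => sq_nonneg _)] at hV
    exact (ENNReal.ofReal_le_ofReal_iff hV0).1 hV
  simp_rw [hexp]
  rw [← ofReal_integral_eq_lintegral_ofReal (integrable_finsetSum _ fun j _ => hsqint j)
    (ae_of_all _ fun s => Finset.sum_nonneg fun _ _ => sq_nonneg _)]
  refine ENNReal.ofReal_le_ofReal ?_
  rw [integral_finsetSum _ fun j _ => hsqint j]
  calc _ ≤ ∑ j : Fin d, 1 / (M : ℝ) * ∫ z, φ z j ^ 2 ∂ν := Finset.sum_le_sum fun j _ => hvar j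
    _ = 1 / M * ∫ z, ‖φ z‖ ^ 2 ∂ν := by rw [hφsq, Finset.mul_sum]
    _ ≤ 1 / M * V := by gcongr
    _ = V / M := by ring

end MiniBatch

/-! ### Transfer from the box to the whole space -/

/-- Smoothing at points near `box β` only sees values on `box κ`: all points `w + h + u` with
`w ∈ box β`, `u` in the `α / 2`-box and `h` small lie in `box κ`. -/
def HasMargin (d : ℕ) (β κ : EReal) (α : ℝ) : Prop :=
  ∃ ε > 0, ∀ w ∈ (box β : Set (Vec d)), ∀ h : Vec d, ‖h‖ < ε →
    ∀ u ∈ (box ((α / 2 : ℝ) : EReal) : Set (Vec d)), w + h + u ∈ (box κ : Set (Vec d))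

section Transfer

variable {d p : ℕ} {α : ℝ} {β κ : EReal} {φ g : Vec d → ℝ}

lemma hasMargin_of_lt (d : ℕ) (hβ : 0 < β)
    (hκ : β + ((α / 2 : ℝ) : EReal) < κ ∨ (β = ⊤ ∧ κ = ⊤)) : HasMargin d β κ α := by
  rcases hκ with hκ | ⟨-, rfl⟩
  · induction β with
    | bot => simp at hβ
    | top => simp at hκ
    | coe b =>
      obtain ⟨c, hc, hcκ⟩ := EReal.lt_iff_exists_real_btwn.1 hκ
      rw [← EReal.coe_add, EReal.coe_lt_coe_iff] at hc
      refine ⟨c - (b + α / 2), by linarith, fun w hw h hh u hu i => ?_⟩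
      refine le_trans (EReal.coe_le_coe_iff.2 ?_) hcκ.le
      have h1 := EReal.coe_le_coe_iff.1 (hw i)
      have h2 := EReal.coe_le_coe_iff.1 (hu i)
      have h3 : |h i| ≤ ‖h‖ := by simpa using PiLp.norm_apply_le h i
      calc |(w + h + u) i| ≤ |w i| + |h i| + |u i| := by
            simpa using abs_add_three (w i) (h i) (u i)
        _ ≤ c := by linarith
  · exact ⟨1, one_pos, fun _ _ _ _ _ _ i => le_top⟩

lemma HasMargin.add_mem (hm : HasMargin d β κ α) {w u : Vec d} (hw : w ∈ (box β : Set (Vec d)))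
    (hu : u ∈ (box ((α / 2 : ℝ) : EReal) : Set (Vec d))) : w + u ∈ (box κ : Set (Vec d)) := by
  obtain ⟨ε, hε, h⟩ := hm
  simpa using h w hw 0 (by simpa using hε) u hu

lemma HasMargin.mem_nhds (hm : HasMargin d β κ α) {w u : Vec d}
    (hw : w ∈ (box β : Set (Vec d))) (hu : u ∈ (box ((α / 2 : ℝ) : EReal) : Set (Vec d))) :
    (box κ : Set (Vec d)) ∈ 𝓝 (w + u) := by
  obtain ⟨ε, hε, h⟩ := hm
  refine Filter.mem_of_superset (Metric.ball_mem_nhds (w + u) hε) fun y hy => ?_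
  rw [mem_ball_iff_norm] at hy
  have := h w hw (y - (w + u)) hy u hu
  rwa [show w + (y - (w + u)) + u = y by abel] at this

lemma setCoord_add (w u : Vec d) (i : Fin d) (c : ℝ) :
    setCoord (w + u) i (w i + c) = w + setCoord u i c := by
  ext j
  by_cases h : j = i
  · subst h; simp [setCoord]
  · simp [setCoord, h]

lemma setCoord_mem_box {r c : ℝ} {u : Vec d} (hu : u ∈ (box (r : EReal) : Set (Vec d)))
    (i : Fin d) (hc : |c| ≤ r) : setCoord u i c ∈ (box (r : EReal) : Set (Vec d)) := fun j => by
  by_cases h : j = i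
  · subst h; simpa [setCoord] using hc
  · simpa [setCoord, h] using hu j

lemma HasMargin.setCoord_mem (hm : HasMargin d β κ α) (hα : 0 < α) {w u : Vec d}
    (hw : w ∈ (box β : Set (Vec d))) (hu : u ∈ (box ((α / 2 : ℝ) : EReal) : Set (Vec d)))
    (i : Fin d) :
    setCoord (w + u) i (w i + α / 2) ∈ (box κ : Set (Vec d)) ∧
      setCoord (w + u) i (w i - α / 2) ∈ (box κ : Set (Vec d)) := by
  rw [sub_eq_add_neg, setCoord_add, setCoord_add]
  exact ⟨hm.add_mem hw (setCoord_mem_box hu i (abs_of_pos (half_pos hα)).le),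
    hm.add_mem hw (setCoord_mem_box hu i (by rw [abs_neg, abs_of_pos (half_pos hα)]))⟩

lemma coordDiff_congr (hm : HasMargin d β κ α) (hα : 0 < α)
    (hφ : Set.EqOn φ g (box κ)) {w u : Vec d} (hw : w ∈ (box β : Set (Vec d)))
    (hu : u ∈ (box ((α / 2 : ℝ) : EReal) : Set (Vec d))) :
    coordDiff α φ w u = coordDiff α g w u := by
  unfold coordDiff
  congr 1
  ext i
  have := hm.setCoord_mem hα hw hu i
  rw [hφ this.1, hφ this.2]

lemma gradient_congr_of_eventuallyEq {x : Vec d} (h : φ =ᶠ[𝓝 x] g) :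
    gradient φ x = gradient g x := by
  rw [gradient, gradient, h.fderiv_eq]

lemma gradient_shift_congr (hm : HasMargin d β κ α)
    (hφ : Set.EqOn φ g (box κ)) {w u : Vec d} (hw : w ∈ (box β : Set (Vec d)))
    (hu : u ∈ (box ((α / 2 : ℝ) : EReal) : Set (Vec d))) :
    gradient φ (w + u) = gradient g (w + u) :=
  gradient_congr_of_eventuallyEq (hφ.eventuallyEq_of_mem (hm.mem_nhds hw hu))

lemma smoothed_eventuallyEq (hm : HasMargin d β κ α) (hφ : Set.EqOn φ g (box κ)) {w : Vec d}
    (hw : w ∈ (box β : Set (Vec d))) : smoothed φ α =ᶠ[𝓝 w] smoothed g α := by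
  obtain ⟨ε, hε, h⟩ := hm
  filter_upwards [Metric.ball_mem_nhds w hε] with y hy
  rw [mem_ball_iff_norm] at hy
  refine integral_congr_ae ?_
  filter_upwards [ae_mem_box d α] with u hu
  refine hφ ?_
  have := h w hw (y - w) hy u hu
  rwa [add_sub_cancel] at this

/-- The stationarity distance depends on the function only through its germs at points of `A`. -/
lemma statDist_congr {A : Set (Vec d)} (h : ∀ x ∈ A, φ =ᶠ[𝓝 x] g) :
    statDist φ A = statDist g A := by
  ext x
  by_cases hx : x ∈ A
  · rw [statDist, statDist, gradient_congr_of_eventuallyEq (h x hx)]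
  · have : mordukhovichNormalCone x A = ∅ :=
      Set.eq_empty_of_forall_notMem fun v hv => hx hv.1
    simp [statDist, this]

lemma exists_measurable_extension {Y : Type*} [MeasurableSpace Y] [Nonempty Y]
    {B : Set (Vec d)} (hB : MeasurableSet B) {h : Vec d → Vec p → Y}
    (hh : Measurable fun z : B × Vec p => h z.1 z.2) :
    ∃ H : Vec d × Vec p → Y, Measurable H ∧ ∀ w ∈ B, ∀ x, H (w, x) = h w x := by
  have he : MeasurableEmbedding (Prod.map (Subtype.val : B → Vec d) (id : Vec p → Vec p)) :=
    (MeasurableEmbedding.subtype_coe hB).prodMap MeasurableEmbedding.id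
  obtain ⟨H, hH, hHe⟩ := he.exists_measurable_extend hh fun _ => inferInstance
  exact ⟨H, hH, fun w hw x => congrFun hHe (⟨w, hw⟩, x)⟩

end Transfer

/-! ### The stochastic loss and the stochastic gradients -/

section Oracle

variable {d p : ℕ} {α : ℝ} {β κ : EReal} {F : Vec d → Vec p → ℝ} {L : Vec p → ℝ}
  {Pξ : Measure (Vec p)}

lemma IsStochasticLoss.integrable_L [IsProbabilityMeasure Pξ] (hF : IsStochasticLoss κ F L Pξ) :
    Integrable L Pξ :=
  ((memLp_two_iff_integrable_sq hF.measurable_L.aestronglyMeasurable).2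
    hF.sq_integrable).integrable one_le_two

lemma IsStochasticLoss.ae_nonneg (hd : 0 < d) (hα : 0 < α) (hβ : 0 < β)
    (hm : HasMargin d β κ α) (hF : IsStochasticLoss κ F L Pξ) : ∀ᵐ x ∂Pξ, 0 ≤ L x := by
  have h0 : (0 : Vec d) ∈ (box β : Set (Vec d)) := fun i => by simpa using hβ.le
  have hz : (0 : Vec d) ∈ (box ((α / 2 : ℝ) : EReal) : Set (Vec d)) := fun i => by
    simpa using (half_pos hα).le
  have hs := setCoord_mem_box hz ⟨0, hd⟩ (abs_of_pos (half_pos hα)).le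
  have h1 := hm.add_mem h0 hz
  have h2 := hm.add_mem h0 hs
  filter_upwards [hF.lipschitz] with x hx
  have h3 := (abs_nonneg _).trans (hx _ h2 _ h1)
  have h4 : ‖(0 : Vec d) + setCoord 0 ⟨0, hd⟩ (α / 2) - (0 + 0)‖ = α / 2 := by
    have : (0 : Vec d) + 0 = setCoord 0 ⟨0, hd⟩ 0 := by ext j; simp [setCoord]
    rw [this, zero_add, norm_setCoord_sub_setCoord, sub_zero, abs_of_pos (half_pos hα)]
  rw [h4] at h3
  exact nonneg_of_mul_nonneg_left h3 (half_pos hα)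

lemma lipschitzOnWith_expLoss [IsProbabilityMeasure Pξ] (hF : IsStochasticLoss κ F L Pξ)
    {C : NNReal} (hC : (C : ℝ) = ∫ x, L x ∂Pξ) : LipschitzOnWith C (expLoss F Pξ) (box κ) := by
  refine LipschitzOnWith.of_dist_le_mul fun w hw w' hw' => ?_
  rw [expLoss, expLoss, dist_eq_norm, dist_eq_norm,
    ← integral_sub (hF.integrable w hw) (hF.integrable w' hw'), hC, ← integral_mul_const]
  refine norm_integral_le_of_norm_le (hF.integrable_L.mul_const _) ?_
  filter_upwards [hF.lipschitz] with x hx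
  exact hx w hw w' hw'

/-- Almost every sample function extends to a globally Lipschitz function. -/
lemma ae_exists_lipschitz_extension (hF : IsStochasticLoss κ F L Pξ) (hL : ∀ᵐ x ∂Pξ, 0 ≤ L x) :
    ∀ᵐ x ∂Pξ, ∃ g : Vec d → ℝ, LipschitzWith (L x).toNNReal g ∧
      Set.EqOn (fun w => F w x) g (box κ) := by
  filter_upwards [hF.lipschitz, hL] with x hx hLx
  refine LipschitzOnWith.extend_real (LipschitzOnWith.of_dist_le_mul fun w hw w' hw' => ?_)
  rw [dist_eq_norm, dist_eq_norm, Real.coe_toNNReal _ hLx]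
  exact hx w hw w' hw'

/-- A single-sample stochastic gradient of `f_α` on `box β` with second moment at most `V`: a
jointly measurable function of the point and the sample `(u, ξ)`. -/
structure IsOracle (β : EReal) (α : ℝ) (F : Vec d → Vec p → ℝ) (Pξ : Measure (Vec p)) (V : ℝ)
    (Φ : Vec d → Vec d × Vec p → Vec d) : Prop where
  measurable : Measurable (Function.uncurry Φ)
  unbiased : ∀ w ∈ (box β : Set (Vec d)), ∫ z, Φ w z ∂((unifBox d α).prod Pξ) =
    gradient (smoothed (expLoss F Pξ) α) w
  sq_le : ∀ w ∈ (box β : Set (Vec d)),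
    ∫⁻ z, ENNReal.ofReal (‖Φ w z‖ ^ 2) ∂((unifBox d α).prod Pξ) ≤ ENNReal.ofReal V

lemma ae_prod_of_ae_left [IsProbabilityMeasure Pξ] (hα : 0 < α) {q : Vec d → Prop}
    (h : ∀ᵐ u ∂(unifBox d α), q u) : ∀ᵐ z ∂((unifBox d α).prod Pξ), q z.1 := by
  have := isProbabilityMeasure_unifBox (d := d) hα
  exact Measure.quasiMeasurePreserving_fst.ae h

lemma ae_prod_of_ae_right [IsProbabilityMeasure Pξ] (hα : 0 < α) {q : Vec p → Prop}
    (h : ∀ᵐ x ∂Pξ, q x) : ∀ᵐ z ∂((unifBox d α).prod Pξ), q z.2 := by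
  have := isProbabilityMeasure_unifBox (d := d) hα
  exact Measure.quasiMeasurePreserving_snd.ae h

lemma lintegral_sq_le_of_ae_norm_le [IsProbabilityMeasure Pξ] (hα : 0 < α)
    (hF : IsStochasticLoss κ F L Pξ) {c : ℝ} (hc : 0 ≤ c) {φ : Vec d × Vec p → Vec d}
    (hφ : ∀ᵐ z ∂((unifBox d α).prod Pξ), ‖φ z‖ ≤ √c * L z.2) :
    ∫⁻ z, ENNReal.ofReal (‖φ z‖ ^ 2) ∂((unifBox d α).prod Pξ) ≤
      ENNReal.ofReal (c * ∫ x, L x ^ 2 ∂Pξ) := by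
  have := isProbabilityMeasure_unifBox (d := d) hα
  calc ∫⁻ z, ENNReal.ofReal (‖φ z‖ ^ 2) ∂((unifBox d α).prod Pξ)
      ≤ ∫⁻ z, ENNReal.ofReal (c * L z.2 ^ 2) ∂((unifBox d α).prod Pξ) := by
        refine lintegral_mono_ae ?_
        filter_upwards [hφ] with z hz
        refine ENNReal.ofReal_le_ofReal ?_
        calc ‖φ z‖ ^ 2 ≤ (√c * L z.2) ^ 2 := pow_le_pow_left₀ (norm_nonneg _) hz 2
          _ = c * L z.2 ^ 2 := by rw [mul_pow, Real.sq_sqrt hc]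
    _ = ∫⁻ x, ENNReal.ofReal (c * L x ^ 2) ∂Pξ := by
        refine (measurePreserving_snd (μ := unifBox d α) (ν := Pξ)).lintegral_comp
          (f := fun x => ENNReal.ofReal (c * L x ^ 2)) ?_
        exact ((hF.measurable_L.pow_const 2).const_mul c).ennreal_ofReal
    _ = ENNReal.ofReal (c * ∫ x, L x ^ 2 ∂Pξ) := by
        rw [← integral_const_mul, ofReal_integral_eq_lintegral_ofReal
          (hF.sq_integrable.const_mul c) (ae_of_all _ fun x => by positivity)]

lemma ae_norm_coordDiff_le [IsProbabilityMeasure Pξ] (hd : 0 < d) (hα : 0 < α) (hβ : 0 < β)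
    (hm : HasMargin d β κ α) (hF : IsStochasticLoss κ F L Pξ) {w : Vec d}
    (hw : w ∈ (box β : Set (Vec d))) :
    ∀ᵐ z ∂((unifBox d α).prod Pξ), ‖α⁻¹ • coordDiff α (fun y => F y z.2) w z.1‖ ≤
      √(d : ℝ) * L z.2 := by
  have hL := hF.ae_nonneg hd hα hβ hm
  filter_upwards [ae_prod_of_ae_left (Pξ := Pξ) hα (ae_mem_box d α),
    ae_prod_of_ae_right (d := d) hα (ae_exists_lipschitz_extension hF hL),
    ae_prod_of_ae_right (d := d) hα hL] with z hz ⟨g, hg, hFg⟩ hLz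
  rw [coordDiff_congr hm hα hFg hw hz, norm_smul, Real.norm_of_nonneg (by positivity)]
  have h := norm_le_sqrt_mul_of_forall_abs_le (by positivity) (abs_coordDiff_le hα.le hg w z.1)
  rw [Real.coe_toNNReal _ hLz] at h
  calc α⁻¹ * ‖coordDiff α g w z.1‖ ≤ α⁻¹ * (√(d : ℝ) * (L z.2 * α)) := by gcongr
    _ = √(d : ℝ) * L z.2 := by field_simp

lemma integrable_of_ae_norm_le [IsProbabilityMeasure Pξ] (hα : 0 < α)
    (hF : IsStochasticLoss κ F L Pξ) {c : ℝ} {φ : Vec d × Vec p → Vec d}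
    (hφm : AEStronglyMeasurable φ ((unifBox d α).prod Pξ))
    (hφ : ∀ᵐ z ∂((unifBox d α).prod Pξ), ‖φ z‖ ≤ c * L z.2) :
    Integrable φ ((unifBox d α).prod Pξ) := by
  have := isProbabilityMeasure_unifBox (d := d) hα
  refine Integrable.mono' (g := fun z => c * L z.2) ?_ hφm hφ
  exact (hF.integrable_L.comp_snd (unifBox d α)).const_mul c

/-- The zeroth-order oracle, up to its values off the box. -/
lemma exists_isOracle_zerothOrder [IsProbabilityMeasure Pξ] (hd : 0 < d) (hα : 0 < α) (hβ : 0 < β)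
    (hm : HasMargin d β κ α) (hF : IsStochasticLoss κ F L Pξ) (hL₀ : 0 ≤ ∫ x, L x ∂Pξ) :
    ∃ Φ : Vec d → Vec d × Vec p → Vec d,
      IsOracle β α F Pξ (d * ∫ x, L x ^ 2 ∂Pξ) Φ ∧
      ∀ w ∈ (box β : Set (Vec d)), ∀ u ∈ (box ((α / 2 : ℝ) : EReal) : Set (Vec d)), ∀ x,
        Φ w (u, x) = α⁻¹ • coordDiff α (fun y => F y x) w u := by
  have := isProbabilityMeasure_unifBox (d := d) hα
  obtain ⟨H, hH, hHF⟩ := exists_measurable_extension (isClosed_box κ).measurableSet hF.measurable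
  set Φ : Vec d → Vec d × Vec p → Vec d := fun w z =>
    α⁻¹ • coordDiff α (fun y => H (y, z.2)) w z.1 with hΦ
  have heq : ∀ w ∈ (box β : Set (Vec d)), ∀ u ∈ (box ((α / 2 : ℝ) : EReal) : Set (Vec d)), ∀ x,
      Φ w (u, x) = α⁻¹ • coordDiff α (fun y => F y x) w u := fun w hw u hu x => by
    simp only [hΦ]
    rw [coordDiff_congr hm hα (fun y hy => hHF y hy x) hw hu]
  have hmeas : Measurable (Function.uncurry Φ) := by
    have hpt : ∀ (i : Fin d) (c : ℝ), Measurable fun q : Vec d × Vec d × Vec p =>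
        H (setCoord (q.1 + q.2.1) i (q.1 i + c), q.2.2) := fun i c => by
      refine hH.comp (Measurable.prodMk ?_ (by fun_prop))
      exact (continuous_setCoord i).measurable.comp
        (f := fun q : Vec d × Vec d × Vec p => (q.1 + q.2.1, q.1 i + c)) (by fun_prop)
    refine Measurable.const_smul ?_ α⁻¹
    refine (PiLp.continuous_toLp 2 _).measurable.comp (measurable_pi_iff.2 fun i => ?_)
    simp only [sub_eq_add_neg (_ : ℝ) (α / 2)]
    exact (hpt i (α / 2)).sub (hpt i (-(α / 2)))
  have hae : ∀ w ∈ (box β : Set (Vec d)), ∀ᵐ z ∂((unifBox d α).prod Pξ),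
      Φ w z = α⁻¹ • coordDiff α (fun y => F y z.2) w z.1 := fun w hw => by
    filter_upwards [ae_prod_of_ae_left (Pξ := Pξ) hα (ae_mem_box d α)] with z hz
    exact heq w hw z.1 hz z.2
  have hnorm : ∀ w ∈ (box β : Set (Vec d)), ∀ᵐ z ∂((unifBox d α).prod Pξ),
      ‖Φ w z‖ ≤ √(d : ℝ) * L z.2 := fun w hw => by
    filter_upwards [hae w hw, ae_norm_coordDiff_le hd hα hβ hm hF hw] with z h1 h2
    rwa [h1]
  refine ⟨Φ, ⟨hmeas, fun w hw => ?_, fun w hw =>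
    lintegral_sq_le_of_ae_norm_le hα hF (Nat.cast_nonneg d) (hnorm w hw)⟩, heq⟩
  have hint : Integrable (Φ w) ((unifBox d α).prod Pξ) :=
    integrable_of_ae_norm_le hα hF
      (hmeas.comp measurable_prodMk_left).aestronglyMeasurable (hnorm w hw)
  obtain ⟨g, hg, hfg⟩ := (lipschitzOnWith_expLoss hF (C := ⟨_, hL₀⟩) rfl).extend_real
  rw [integral_prod _ hint, gradient_congr_of_eventuallyEq (smoothed_eventuallyEq hm hfg hw),
    gradient_smoothed_eq hα hg]
  refine integral_congr_ae ?_
  filter_upwards [ae_mem_box d α, hint.prod_right_ae] with u hu hiu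
  rw [← coordDiff_congr hm hα hfg hw hu]
  ext i
  rw [integral_vec_apply hiu]
  have hi := hm.setCoord_mem hα hw hu i
  calc ∫ x, Φ w (u, x) i ∂Pξ
      = ∫ x, α⁻¹ * (F (setCoord (w + u) i (w i + α / 2)) x -
          F (setCoord (w + u) i (w i - α / 2)) x) ∂Pξ :=
        integral_congr_ae (ae_of_all _ fun x => by simp [heq w hw u hu x, coordDiff])
    _ = _ := by
        rw [integral_const_mul, integral_sub (hF.integrable _ hi.1) (hF.integrable _ hi.2)]
        simp [coordDiff, expLoss]

/-- The first-order oracle, up to its values off the box. It has the same mean as the zeroth-order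
one: for almost every fixed `ξ`, the mean of the gradient over `u` equals the mean of the
difference quotient over `u`. -/
lemma exists_isOracle_firstOrder [IsProbabilityMeasure Pξ] (hd : 0 < d) (hα : 0 < α) (hβ : 0 < β)
    (hm : HasMargin d β κ α) (hF : IsStochasticLoss κ F L Pξ) (hL₀ : 0 ≤ ∫ x, L x ∂Pξ)
    {gF : Vec d → Vec p → Vec d} (hgF : IsAEGradient β α F Pξ gF) :
    ∃ Φ : Vec d → Vec d × Vec p → Vec d,
      IsOracle β α F Pξ (∫ x, L x ^ 2 ∂Pξ) Φ ∧
      ∀ w ∈ (box β : Set (Vec d)), ∀ u ∈ (box ((α / 2 : ℝ) : EReal) : Set (Vec d)), ∀ x,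
        Φ w (u, x) = gF (w + u) x := by
  have := isProbabilityMeasure_unifBox (d := d) hα
  obtain ⟨H, hH, hHF⟩ := exists_measurable_extension (isClosed_box _).measurableSet hgF.measurable
  have hL := hF.ae_nonneg hd hα hβ hm
  have heq : ∀ w ∈ (box β : Set (Vec d)), ∀ u ∈ (box ((α / 2 : ℝ) : EReal) : Set (Vec d)), ∀ x,
      H (w + u, x) = gF (w + u) x := fun w hw u hu x => by
    refine hHF _ (fun i => ?_) x
    refine le_trans ?_ (add_le_add (hw i) (hu i))
    rw [← EReal.coe_add, EReal.coe_le_coe_iff]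
    exact abs_add_le (w i) (u i)
  have hae : ∀ w ∈ (box β : Set (Vec d)), ∀ᵐ z ∂((unifBox d α).prod Pξ),
      H (w + z.1, z.2) = gradient (fun y => F y z.2) (w + z.1) := fun w hw => by
    filter_upwards [ae_prod_of_ae_left (Pξ := Pξ) hα (ae_mem_box d α), hgF.ae_eq w hw] with z hz h
    rw [heq w hw z.1 hz, h]
  have hnorm : ∀ w ∈ (box β : Set (Vec d)), ∀ᵐ z ∂((unifBox d α).prod Pξ),
      ‖H (w + z.1, z.2)‖ ≤ √1 * L z.2 := fun w hw => by
    filter_upwards [hae w hw, ae_prod_of_ae_left (Pξ := Pξ) hα (ae_mem_box d α),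
      ae_prod_of_ae_right (d := d) hα (ae_exists_lipschitz_extension hF hL),
      ae_prod_of_ae_right (d := d) hα hL] with z h1 hz ⟨g, hg, hFg⟩ hLz
    rw [h1, gradient_shift_congr hm hFg hw hz, Real.sqrt_one, one_mul]
    simpa [Real.coe_toNNReal _ hLz] using norm_gradient_le hg (w + z.1)
  obtain ⟨Φ₀, hΦ₀, hΦ₀eq⟩ := exists_isOracle_zerothOrder hd hα hβ hm hF hL₀
  have hmeas : Measurable (Function.uncurry fun (w : Vec d) (z : Vec d × Vec p) =>
      H (w + z.1, z.2)) :=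
    hH.comp (f := fun q : Vec d × Vec d × Vec p => (q.1 + q.2.1, q.2.2)) (by fun_prop)
  refine ⟨fun w z => H (w + z.1, z.2), ⟨hmeas, fun w hw => ?_, fun w hw => ?_⟩, heq⟩
  · rw [← hΦ₀.unbiased w hw]
    have hint : Integrable (fun z : Vec d × Vec p => H (w + z.1, z.2)) ((unifBox d α).prod Pξ) :=
      integrable_of_ae_norm_le hα hF
        (hmeas.comp measurable_prodMk_left).aestronglyMeasurable (hnorm w hw)
    have hint₀ : Integrable (Φ₀ w) ((unifBox d α).prod Pξ) :=
      (memLp_two_of_lintegral_le (hΦ₀.measurable.comp measurable_prodMk_left)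
        (hΦ₀.sq_le w hw)).integrable one_le_two
    rw [integral_prod_symm _ hint, integral_prod_symm _ hint₀]
    -- Only now is `ξ` fixed, so no joint measurability of differentiability points is needed.
    have hswap : ∀ᵐ x ∂Pξ, ∀ᵐ u ∂(unifBox d α),
        H (w + u, x) = gradient (fun y => F y x) (w + u) :=
      Measure.ae_ae_of_ae_prod
        (p := fun q : Vec p × Vec d => H (w + q.2, q.1) = gradient (fun y => F y q.1) (w + q.2))
        ((Measure.measurePreserving_swap (μ := Pξ)
          (ν := unifBox d α)).quasiMeasurePreserving.ae (hae w hw))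
    refine integral_congr_ae ?_
    filter_upwards [hswap, ae_exists_lipschitz_extension hF hL] with x hx ⟨g, hg, hFg⟩
    calc ∫ u, H (w + u, x) ∂(unifBox d α) = ∫ u, gradient g (w + u) ∂(unifBox d α) := by
          refine integral_congr_ae ?_
          filter_upwards [hx, ae_mem_box d α] with u hu hub
          rw [hu, gradient_shift_congr hm hFg hw hub]
      _ = ∫ u, α⁻¹ • coordDiff α g w u ∂(unifBox d α) := integral_gradient_eq hα hg w
      _ = ∫ u, Φ₀ w (u, x) ∂(unifBox d α) := by
          refine integral_congr_ae ?_
          filter_upwards [ae_mem_box d α] with u hu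
          rw [hΦ₀eq w hw u hu x, coordDiff_congr hm hα hFg hw hu]
  · simpa using lintegral_sq_le_of_ae_norm_le hα hF zero_le_one (hnorm w hw)

lemma exists_oracle_direction [IsProbabilityMeasure Pξ] (hd : 0 < d) (hα : 0 < α) (hβ : 0 < β)
    (hm : HasMargin d β κ α) (hF : IsStochasticLoss κ F L Pξ) (hL₀ : 0 ≤ ∫ x, L x ∂Pξ)
    (v : Version) {gF : Vec d → Vec p → Vec d}
    (hgF : v = Version.firstOrder → IsAEGradient β α F Pξ gF) (M : ℕ) :
    ∃ Φ : Vec d → Vec d × Vec p → Vec d,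
      IsOracle β α F Pξ (v.factor d * ∫ x, L x ^ 2 ∂Pξ) Φ ∧
      ∀ w ∈ (box β : Set (Vec d)), ∀ (u : Fin M → Vec d) (x : Fin M → Vec p),
        (∀ i, u i ∈ (box ((α / 2 : ℝ) : EReal) : Set (Vec d))) →
        direction v F gF α w u x = (1 / (M : ℝ)) • ∑ i, Φ w (u i, x i) := by
  cases v with
  | zerothOrder =>
    obtain ⟨Φ, hΦ, heq⟩ := exists_isOracle_zerothOrder hd hα hβ hm hF hL₀
    refine ⟨Φ, hΦ, fun w hw u x hu => ?_⟩
    simp only [direction, finDiff_eq_coordDiff]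
    rw [Finset.sum_congr rfl fun i _ => heq w hw (u i) (hu i) (x i), ← Finset.smul_sum, smul_smul]
    congr 1
    rw [one_div, one_div, mul_inv]
  | firstOrder =>
    obtain ⟨Φ, hΦ, heq⟩ := exists_isOracle_firstOrder hd hα hβ hm hF hL₀ (hgF rfl)
    refine ⟨Φ, by simpa [Version.factor] using hΦ, fun w hw u x hu => ?_⟩
    simp only [direction]
    rw [Finset.sum_congr rfl fun i _ => heq w hw (u i) (hu i) (x i)]

end Oracle

/-! ### Law of the iterates -/

lemma history_le_comap {Ω ι : Type*} {d p M k : ℕ} {u : ℕ → Fin M → Ω → Vec d}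
    {ξ : ℕ → Fin M → Ω → Vec p} {X : Ω → ι → Vec d × Vec p}
    (h : ∀ j ∈ Finset.Icc 1 k, ∀ i, ∃ s, ∀ ω, X ω s = (u j i ω, ξ j i ω)) :
    history u ξ k ≤ MeasurableSpace.comap X inferInstance := by
  refine iSup₂_le fun j hj => iSup_le fun i => ?_
  obtain ⟨s, hs⟩ := h j hj i
  have : (fun ω => (u j i ω, ξ j i ω)) = (fun y : ι → Vec d × Vec p => y s) ∘ X :=
    funext fun ω => (hs ω).symm
  rw [this, ← MeasurableSpace.comap_comp]
  exact MeasurableSpace.comap_mono (measurable_pi_apply s).comap_le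

section Run

variable {Ω : Type*} [mΩ : MeasurableSpace Ω] {d p M K : ℕ} {P : Measure Ω}
  {v : Version} {F : Vec d → Vec p → ℝ} {gF : Vec d → Vec p → Vec d}
  {Pξ : Measure (Vec p)} {α η : ℝ} {β : EReal} {A : Set (Vec d)} {w1 : Vec d}
  {u : ℕ → Fin M → Ω → Vec d} {ξ : ℕ → Fin M → Ω → Vec p} {R : Ω → ℕ} {w : ℕ → Ω → Vec d}

lemma IsRun.measurable_sample (hrun : IsRun P v F gF Pξ α A w1 η K u ξ R w) {k : ℕ}
    (hk : k ∈ Finset.Icc 1 K) (i : Fin M) : Measurable fun ω => (u k i ω, ξ k i ω) :=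
  (hrun.measurable_u k hk i).prodMk (hrun.measurable_ξ k hk i)

lemma IsRun.measurable_history (hrun : IsRun P v F gF Pξ α A w1 η K u ξ R w) {n : ℕ}
    (hn : n ≤ K) : Measurable[history u ξ n] (w (n + 1)) := by
  rcases Nat.eq_zero_or_pos n with rfl | hpos
  · rw [show w (0 + 1) = fun _ => w1 from funext hrun.init]
    exact measurable_const
  · exact hrun.adapted n (Finset.mem_Icc.2 ⟨hpos, hn⟩)

/-- Any random element from which all samples of the iterations `1, …, n` can be read off also
determines `w^{n+1}`. -/
lemma IsRun.comap_le {ι : Type*} {X : Ω → ι → Vec d × Vec p}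
    (hrun : IsRun P v F gF Pξ α A w1 η K u ξ R w) {n : ℕ} (hn : n ≤ K)
    (h : ∀ j ∈ Finset.Icc 1 n, ∀ i, ∃ s, ∀ ω, X ω s = (u j i ω, ξ j i ω)) :
    MeasurableSpace.comap (w (n + 1)) inferInstance ≤ MeasurableSpace.comap X inferInstance :=
  (hrun.measurable_history hn).comap_le.trans (history_le_comap h)

lemma IsRun.measurable_iterate (hrun : IsRun P v F gF Pξ α A w1 η K u ξ R w) {n : ℕ}
    (hn : n ≤ K) : Measurable (w (n + 1)) := by
  refine (hrun.measurable_history hn).mono (iSup₂_le fun j hj => iSup_le fun i => ?_) le_rfl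
  rw [Finset.mem_Icc] at hj
  exact (hrun.measurable_sample (Finset.mem_Icc.2 ⟨hj.1, hj.2.trans hn⟩) i).comap_le

lemma IsRun.ae_mem (hrun : IsRun P v F gF Pξ α A w1 η K u ξ R w) (hw1 : w1 ∈ A) :
    ∀ᵐ ω ∂P, ∀ n ≤ K, w (n + 1) ω ∈ A := by
  rw [ae_all_iff]
  intro n
  rcases Nat.eq_zero_or_pos n with rfl | hpos
  · exact ae_of_all _ fun ω _ => by rw [zero_add, hrun.init ω]; exact hw1
  · by_cases hn : n ≤ K
    · filter_upwards [hrun.step n (Finset.mem_Icc.2 ⟨hpos, hn⟩)] with ω hω _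
      exact hω.1
    · exact ae_of_all _ fun ω h => absurd h hn

lemma IsRun.ae_sample_mem_box [IsProbabilityMeasure Pξ] (hα : 0 < α)
    (hrun : IsRun P v F gF Pξ α A w1 η K u ξ R w) {k : ℕ} (hk : k ∈ Finset.Icc 1 K) :
    ∀ᵐ ω ∂P, ∀ i, u k i ω ∈ (box ((α / 2 : ℝ) : EReal) : Set (Vec d)) := by
  rw [ae_all_iff]
  intro i
  have h := ae_prod_of_ae_left (Pξ := Pξ) hα (ae_mem_box d α)
  rw [← hrun.law_sample k hk i] at h
  exact ae_of_ae_map (hrun.measurable_sample hk i).aemeasurable h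

lemma IsRun.map_batch [IsProbabilityMeasure P] (hrun : IsRun P v F gF Pξ α A w1 η K u ξ R w) {k : ℕ}
    (hk : k ∈ Finset.Icc 1 K) :
    P.map (fun ω (i : Fin M) => (u k i ω, ξ k i ω)) =
      Measure.pi fun _ : Fin M => (unifBox d α).prod Pξ := by
  have h := hrun.indep_samples.precomp (g := fun i : Fin M => ((⟨k, hk⟩ : Finset.Icc 1 K), i))
    fun i j hij => (Prod.mk.inj hij).2
  rw [h.map_fun_eq_pi_map fun i => (hrun.measurable_sample hk i).aemeasurable]
  congr 1
  ext1 i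
  exact hrun.law_sample k hk i

lemma IsRun.indepFun_iterate_batch (hrun : IsRun P v F gF Pξ α A w1 η K u ξ R w) {n : ℕ}
    (hn : n + 1 ∈ Finset.Icc 1 K) :
    IndepFun (w (n + 1)) (fun ω (i : Fin M) => (u (n + 1) i ω, ξ (n + 1) i ω)) P := by
  classical
  have hnK : n + 1 ≤ K := (Finset.mem_Icc.1 hn).2
  -- Split the samples into those of the iterations `1, …, n` and those of iteration `n + 1`.
  set S : Finset (Finset.Icc 1 K × Fin M) := Finset.univ.filter fun ki => (ki.1 : ℕ) ≤ n with hS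
  set T : Finset (Finset.Icc 1 K × Fin M) := Finset.univ.filter fun ki => (ki.1 : ℕ) = n + 1
    with hT
  have hdisj : Disjoint S T := by
    rw [Finset.disjoint_left]
    intro ki h1 h2
    simp only [hS, hT, Finset.mem_filter, Finset.mem_univ, true_and] at h1 h2
    omega
  have hind := hrun.indep_samples.indepFun_finset S T hdisj
    fun ki => hrun.measurable_sample ki.1.2 ki.2
  have hTmem : ∀ i : Fin M, ((⟨n + 1, hn⟩ : Finset.Icc 1 K), i) ∈ T := fun i => by simp [hT]
  have hind' := hind.comp (φ := id)
    (ψ := fun (y : T → Vec d × Vec p) (i : Fin M) => y ⟨(⟨n + 1, hn⟩, i), hTmem i⟩)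
    measurable_id (measurable_pi_iff.2 fun i => measurable_pi_apply _)
  rw [IndepFun_iff_Indep] at hind' ⊢
  refine indep_of_indep_of_le_left hind' (hrun.comap_le (by omega) fun j hj i => ?_)
  rw [Finset.mem_Icc] at hj
  exact ⟨⟨(⟨j, Finset.mem_Icc.2 ⟨hj.1, by omega⟩⟩, i), by simpa [hS] using hj.2⟩, fun ω => rfl⟩

lemma IsRun.indepFun_index_iterate (hrun : IsRun P v F gF Pξ α A w1 η K u ξ R w) {n : ℕ}
    (hn : n ≤ K) : IndepFun R (w (n + 1)) P := by
  have h := hrun.indep_R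
  rw [IndepFun_iff_Indep] at h ⊢
  refine indep_of_indep_of_le_right h (hrun.comap_le hn fun j hj i => ?_)
  rw [Finset.mem_Icc] at hj
  exact ⟨(⟨j, Finset.mem_Icc.2 ⟨hj.1, hj.2.trans hn⟩⟩, i), fun ω => rfl⟩

/-- A bound on the conditional mean given the current iterate, valid at every admissible point,
integrates to a bound on the mean. -/
lemma IsRun.lintegral_le_of_forall [IsProbabilityMeasure P] [IsProbabilityMeasure Pξ] (hα : 0 < α)
    (hrun : IsRun P v F gF Pξ α A w1 η K u ξ R w) (hw1 : w1 ∈ A) {n : ℕ}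
    (hn : n + 1 ∈ Finset.Icc 1 K) {Ψ : Vec d × (Fin M → Vec d × Vec p) → ℝ≥0∞} (hΨ : Measurable Ψ)
    {c : ℝ≥0∞} (hA : MeasurableSet A)
    (hc : ∀ y ∈ A, ∫⁻ s, Ψ (y, s) ∂(Measure.pi fun _ : Fin M => (unifBox d α).prod Pξ) ≤ c) :
    ∫⁻ ω, Ψ (w (n + 1) ω, fun i => (u (n + 1) i ω, ξ (n + 1) i ω)) ∂P ≤ c := by
  have := isProbabilityMeasure_unifBox (d := d) hα
  have hnK : n + 1 ≤ K := (Finset.mem_Icc.1 hn).2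
  have hw := hrun.measurable_iterate (n := n) (by omega)
  have hs : Measurable fun ω (i : Fin M) => (u (n + 1) i ω, ξ (n + 1) i ω) :=
    measurable_pi_iff.2 fun i => hrun.measurable_sample hn i
  have hprob := Measure.isProbabilityMeasure_map (μ := P) hw.aemeasurable
  rw [← lintegral_map hΨ (hw.prodMk hs),
    (indepFun_iff_map_prod_eq_prod_map_map hw.aemeasurable hs.aemeasurable).1
      (hrun.indepFun_iterate_batch hn), hrun.map_batch hn, lintegral_prod _ hΨ.aemeasurable]
  have hmem : ∀ᵐ y ∂(P.map (w (n + 1))), y ∈ A := by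
    refine (ae_map_iff hw.aemeasurable (p := fun y => y ∈ A) hA).2 ?_
    filter_upwards [hrun.ae_mem hw1] with ω hω
    exact hω n (by omega)
  calc _ ≤ ∫⁻ _y, c ∂(P.map (w (n + 1))) := by
        refine lintegral_mono_ae ?_
        filter_upwards [hmem] with y hy using hc y hy
    _ = c := by simp

lemma IsRun.ae_index_mem (hrun : IsRun P v F gF Pξ α A w1 η K u ξ R w) :
    ∀ᵐ ω ∂P, R ω ∈ Set.Icc 2 (K + 1) := by
  have h : ∀ᵐ n ∂(P.map R), n ∈ Set.Icc 2 (K + 1) := by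
    rw [hrun.law_R, uniformOn]
    exact ae_cond_mem measurableSet_Icc
  exact ae_of_ae_map hrun.measurable_R.aemeasurable h

lemma IsRun.measure_index_eq (hrun : IsRun P v F gF Pξ α A w1 η K u ξ R w) {k : ℕ}
    (hk : k ∈ Finset.Icc 1 K) : P (R ⁻¹' {k + 1}) = (K : ℝ≥0∞)⁻¹ := by
  rw [Finset.mem_Icc] at hk
  rw [← Measure.map_apply hrun.measurable_R (measurableSet_singleton _), hrun.law_R, uniformOn,
    cond_apply measurableSet_Icc]
  have h1 : Set.Icc 2 (K + 1) ∩ {k + 1} = {k + 1} := by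
    rw [Set.inter_eq_right, Set.singleton_subset_iff]
    exact ⟨by omega, by omega⟩
  have h2 : Measure.count (Set.Icc 2 (K + 1)) = (K : ℝ≥0∞) := by
    rw [← Finset.coe_Icc, Measure.count_apply_finset]
    simp
  rw [h1, h2, Measure.count_singleton, mul_one]

lemma IsRun.ae_eq_sum_index (hrun : IsRun P v F gF Pξ α A w1 η K u ξ R w)
    (D : Vec d → ℝ≥0∞) :
    (fun ω => D (w (R ω) ω)) =ᵐ[P] fun ω =>
      ∑ k ∈ Finset.Icc 1 K, (R ⁻¹' {k + 1}).indicator 1 ω * D (w (k + 1) ω) := by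
  filter_upwards [hrun.ae_index_mem] with ω hω
  have hmem : R ω - 1 ∈ Finset.Icc 1 K := Finset.mem_Icc.2 ⟨by have := hω.1; omega, by
    have := hω.2; omega⟩
  have hR : R ω - 1 + 1 = R ω := by have := hω.1; omega
  rw [Finset.sum_eq_single_of_mem _ hmem fun k _ hk => ?_]
  · rw [hR]; simp
  · have : ω ∉ R ⁻¹' {k + 1} := fun h => hk (by
      simp only [Set.mem_preimage, Set.mem_singleton_iff] at h; omega)
    simp [this]

lemma IsRun.measurable_indicator_index (hrun : IsRun P v F gF Pξ α A w1 η K u ξ R w) (k : ℕ) :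
    Measurable ((R ⁻¹' {k + 1}).indicator (1 : Ω → ℝ≥0∞)) :=
  measurable_one.indicator (hrun.measurable_R (measurableSet_singleton _))

lemma IsRun.aemeasurable_output (hrun : IsRun P v F gF Pξ α A w1 η K u ξ R w)
    {D : Vec d → ℝ≥0∞} (hD : Measurable D) : AEMeasurable (fun ω => D (w (R ω) ω)) P := by
  refine AEMeasurable.congr (Measurable.aemeasurable ?_) (hrun.ae_eq_sum_index D).symm
  refine Finset.measurable_sum _ fun k hk => (hrun.measurable_indicator_index k).mul ?_
  exact hD.comp (hrun.measurable_iterate (Finset.mem_Icc.1 hk).2)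

/-- The expectation at the random output index is the average over the iterates, since the index
is independent of the samples. -/
lemma IsRun.lintegral_output (hrun : IsRun P v F gF Pξ α A w1 η K u ξ R w)
    {D : Vec d → ℝ≥0∞} (hD : Measurable D) :
    ∫⁻ ω, D (w (R ω) ω) ∂P =
      (K : ℝ≥0∞)⁻¹ * ∫⁻ ω, ∑ k ∈ Finset.Icc 1 K, D (w (k + 1) ω) ∂P := by
  have hmeas : ∀ k ∈ Finset.Icc 1 K, Measurable fun ω => D (w (k + 1) ω) := fun k hk =>
    hD.comp (hrun.measurable_iterate (Finset.mem_Icc.1 hk).2)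
  rw [lintegral_congr_ae (hrun.ae_eq_sum_index D),
    lintegral_finsetSum (f := fun k ω => (R ⁻¹' {k + 1}).indicator 1 ω * D (w (k + 1) ω)) _
      fun k hk => (hrun.measurable_indicator_index k).mul (hmeas k hk),
    lintegral_finsetSum _ hmeas, Finset.mul_sum]
  refine Finset.sum_congr rfl fun k hk => ?_
  have hind : IndepFun ((R ⁻¹' {k + 1}).indicator (1 : Ω → ℝ≥0∞)) (fun ω => D (w (k + 1) ω)) P := by
    have h := (hrun.indepFun_index_iterate (Finset.mem_Icc.1 hk).2).comp
      (φ := ({k + 1} : Set ℕ).indicator (1 : ℕ → ℝ≥0∞)) (measurable_of_countable _) hD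
    exact h
  have h := lintegral_mul_eq_lintegral_mul_lintegral_of_indepFun
    (hrun.measurable_indicator_index k) (hmeas k hk) hind
  simp only [Pi.mul_apply] at h
  rw [h, lintegral_indicator_one (hrun.measurable_R (measurableSet_singleton _)),
    hrun.measure_index_eq hk]

/-- The convergence bound for an abstract smooth objective `g` whose gradient on `A` is the mean of
the stochastic gradient oracle. -/
lemma IsRun.lintegral_statDist_sq_le [IsProbabilityMeasure P] [IsProbabilityMeasure Pξ] (hα : 0 < α)
    (hrun : IsRun P v F gF Pξ α A w1 η K u ξ R w) (hw1 : w1 ∈ A) (hA : IsClosed A)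
    (hAβ : A ⊆ box β) (hK : 0 < K) (hM : 0 < M) {V : ℝ} (hV : 0 ≤ V)
    {Φ : Vec d → Vec d × Vec p → Vec d} (hΦ : IsOracle β α F Pξ V Φ)
    (hdir : ∀ y ∈ (box β : Set (Vec d)), ∀ (u : Fin M → Vec d) (x : Fin M → Vec p),
      (∀ i, u i ∈ (box ((α / 2 : ℝ) : EReal) : Set (Vec d))) →
      direction v F gF α y u x = (1 / (M : ℝ)) • ∑ i, Φ y (u i, x i))
    {g : Vec d → ℝ} {ℓ : ℝ} (hg : Differentiable ℝ g) (hℓpos : 0 < ℓ)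
    (hℓ : ∀ x y, ‖gradient g x - gradient g y‖ ≤ ℓ * ‖x - y‖)
    (hgF : ∀ y ∈ A, gradient (smoothed (expLoss F Pξ) α) y = gradient g y)
    {ρ τ : ℝ} (hρ : 0 < ρ) (hτ : 0 ≤ τ) (hρτ : 1 < ρ + τ) (hη : η = 2 / (3 * ρ * ℓ))
    {Δ : ℝ} (hΔ : ∀ y ∈ A, g w1 - g y ≤ Δ) :
    ∫⁻ ω, statDist g A (w (R ω) ω) ^ 2 ∂P ≤
      ENNReal.ofReal (constC1 ρ τ * (ℓ * Δ / K) + constC2 ρ τ M * (V / M)) := by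
  have := isProbabilityMeasure_unifBox (d := d) hα
  have hΔ0 : 0 ≤ Δ := by simpa using hΔ w1 hw1
  have hT : 0 < τ + ρ - 1 := by linarith
  have hMpos : (0 : ℝ) < M := by exact_mod_cast hM
  have hKpos : (0 : ℝ) < K := by exact_mod_cast hK
  have hgcont : Continuous (gradient g) :=
    (LipschitzWith.of_dist_le_mul (K := ⟨ℓ, hℓpos.le⟩) fun x y => by
      rw [dist_eq_norm, dist_eq_norm]; exact hℓ x y).continuous
  have hDmeas : Measurable fun y => statDist g A y ^ 2 :=
    (measurable_statDist hA hgcont.continuousOn).pow_const 2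
  rw [hrun.lintegral_output hDmeas]
  set avg : Vec d × (Fin M → Vec d × Vec p) → Vec d :=
    fun q => (1 / (M : ℝ)) • ∑ i, Φ q.1 (q.2 i) with havg
  have havgm : Measurable avg := by
    have hsum : Measurable fun q : Vec d × (Fin M → Vec d × Vec p) => ∑ i, Φ q.1 (q.2 i) :=
      Finset.measurable_sum _ fun i _ => hΦ.measurable.comp
        (f := fun q : Vec d × (Fin M → Vec d × Vec p) => (q.1, q.2 i)) (by fun_prop)
    exact hsum.const_smul (1 / (M : ℝ))
  have hΦm : ∀ y, Measurable (Φ y) := fun y => hΦ.measurable.comp measurable_prodMk_left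
  set smp : ℕ → Ω → Fin M → Vec d × Vec p := fun k ω i => (u k i ω, ξ k i ω) with hsmp
  set b : ℝ := 3 + 2 * (1 + 3 * ρ) / (τ + ρ - 1) with hb
  set c : ℝ := 2 * (1 + 3 * ρ) / (τ + ρ - 1) * (4 / 3 * (τ / ρ ^ 2)) with hc
  have hb0 : 0 ≤ b := by positivity
  have hc0 : 0 ≤ c := by positivity
  have hpath : ∀ᵐ ω ∂P, ∑ k ∈ Finset.Icc 1 K, statDist g A (w (k + 1) ω) ^ 2 ≤
      ENNReal.ofReal (constC1 ρ τ * (ℓ * Δ)) + ∑ k ∈ Finset.Icc 1 K,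
        (ENNReal.ofReal b *
            ENNReal.ofReal (‖avg (w k ω, smp k ω) - gradient g (w k ω)‖ ^ 2) +
          ENNReal.ofReal c * ENNReal.ofReal (‖avg (w k ω, smp k ω)‖ ^ 2)) := by
    have hstep : ∀ᵐ ω ∂P, ∀ k ∈ Finset.Icc 1 K,
        w (k + 1) ω ∈ proj A (w k ω - η • direction v F gF α (w k ω) (fun i => u k i ω)
          (fun i => ξ k i ω)) ∧
        ∀ i, u k i ω ∈ (box ((α / 2 : ℝ) : EReal) : Set (Vec d)) :=
      (Finset.eventually_all _).2 fun k hk => (hrun.step k hk).and (hrun.ae_sample_mem_box hα hk)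
    filter_upwards [hrun.ae_mem hw1, hstep] with ω hmem hst
    have hx : ∀ k ∈ Finset.Icc 1 K, w k ω ∈ A := fun k hk => by
      rw [Finset.mem_Icc] at hk
      have := hmem (k - 1) (by omega)
      rwa [Nat.sub_add_cancel hk.1] at this
    refine sum_statDist_sq_le (x := fun k => w k ω) hg hℓpos hℓ hρ hτ hρτ hη hx
      (fun k hk => ?_) hΔ0 ?_
    · have h := (hst k hk).1
      rwa [hdir _ (hAβ (hx k hk)) _ _ (hst k hk).2] at h
    · rw [hrun.init ω]
      exact hΔ _ (hmem K le_rfl)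
  have hterm : ∀ k ∈ Finset.Icc 1 K,
      Measurable (fun ω => ENNReal.ofReal (‖avg (w k ω, smp k ω) - gradient g (w k ω)‖ ^ 2)) ∧
      Measurable (fun ω => ENNReal.ofReal (‖avg (w k ω, smp k ω)‖ ^ 2)) ∧
      ∫⁻ ω, ENNReal.ofReal (‖avg (w k ω, smp k ω) - gradient g (w k ω)‖ ^ 2) ∂P ≤
        ENNReal.ofReal (V / M) ∧
      ∫⁻ ω, ENNReal.ofReal (‖avg (w k ω, smp k ω)‖ ^ 2) ∂P ≤ ENNReal.ofReal V := by
    intro k hk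
    obtain ⟨n, rfl⟩ : ∃ n, k = n + 1 := ⟨k - 1, by rw [Finset.mem_Icc] at hk; omega⟩
    have hwm := hrun.measurable_iterate (n := n) (by rw [Finset.mem_Icc] at hk; omega)
    have hsm : Measurable (smp (n + 1)) :=
      measurable_pi_iff.2 fun i => hrun.measurable_sample hk i
    have hψ₁ : Measurable fun q : Vec d × (Fin M → Vec d × Vec p) =>
        ENNReal.ofReal (‖avg q - gradient g q.1‖ ^ 2) :=
      ((havgm.sub (hgcont.measurable.comp measurable_fst)).norm.pow_const 2).ennreal_ofReal
    have hψ₂ : Measurable fun q : Vec d × (Fin M → Vec d × Vec p) =>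
        ENNReal.ofReal (‖avg q‖ ^ 2) := (havgm.norm.pow_const 2).ennreal_ofReal
    refine ⟨hψ₁.comp (hwm.prodMk hsm), hψ₂.comp (hwm.prodMk hsm),
      hrun.lintegral_le_of_forall hα hw1 hk hψ₁ hA.measurableSet fun y hy => ?_,
      hrun.lintegral_le_of_forall hα hw1 hk hψ₂ hA.measurableSet fun y hy => ?_⟩
    · have := lintegral_norm_sq_average_sub_le (hΦm y) hV (hΦ.sq_le y (hAβ hy)) hM
      rwa [hΦ.unbiased y (hAβ hy), hgF y hy] at this
    · exact lintegral_norm_sq_average_le (hΦm y) (hΦ.sq_le y (hAβ hy)) hM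
  have hC : 0 ≤ constC1 ρ τ * (ℓ * Δ) := by rw [constC1]; positivity
  calc (K : ℝ≥0∞)⁻¹ * ∫⁻ ω, ∑ k ∈ Finset.Icc 1 K, statDist g A (w (k + 1) ω) ^ 2 ∂P
      ≤ (K : ℝ≥0∞)⁻¹ * (ENNReal.ofReal (constC1 ρ τ * (ℓ * Δ)) + ∑ k ∈ Finset.Icc 1 K,
          (ENNReal.ofReal b * ENNReal.ofReal (V / M) + ENNReal.ofReal c * ENNReal.ofReal V)) := by
        refine mul_le_mul_right ((lintegral_mono_ae hpath).trans ?_) _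
        rw [lintegral_add_left measurable_const, lintegral_const, measure_univ, mul_one,
          lintegral_finsetSum (f := fun k ω => ENNReal.ofReal b *
              ENNReal.ofReal (‖avg (w k ω, smp k ω) - gradient g (w k ω)‖ ^ 2) +
            ENNReal.ofReal c * ENNReal.ofReal (‖avg (w k ω, smp k ω)‖ ^ 2)) _
            fun k hk => ((hterm k hk).1.const_mul _).add ((hterm k hk).2.1.const_mul _)]
        refine add_le_add le_rfl (Finset.sum_le_sum fun k hk => ?_)
        obtain ⟨hm1, hm2, hi1, hi2⟩ := hterm k hk
        rw [lintegral_add_left (hm1.const_mul _), lintegral_const_mul _ hm1,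
          lintegral_const_mul _ hm2]
        exact add_le_add (mul_le_mul_right hi1 _) (mul_le_mul_right hi2 _)
    _ = ENNReal.ofReal ((K : ℝ)⁻¹ *
          (constC1 ρ τ * (ℓ * Δ) + K * (b * (V / M) + c * V))) := by
        have hB : 0 ≤ b * (V / M) + c * V := by positivity
        rw [Finset.sum_const, Nat.card_Icc, Nat.add_sub_cancel, nsmul_eq_mul,
          ← ENNReal.ofReal_mul hb0, ← ENNReal.ofReal_mul hc0,
          ← ENNReal.ofReal_add (by positivity) (by positivity), ← ENNReal.ofReal_natCast,
          ← ENNReal.ofReal_mul hKpos.le, ← ENNReal.ofReal_add hC (by positivity),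
          ← ENNReal.ofReal_inv_of_pos hKpos, ← ENNReal.ofReal_mul (by positivity)]
    _ = _ := by
        congr 1
        rw [hb, hc, constC2]
        field_simp
        ring

end Run

end SPA

/-! ### The convergence theorem -/

theorem theorem1
    {d p : ℕ} (hd : 0 < d)
    -- smoothing parameter and radii; `β = ⊤` means that the box constraint is absent
    (α : ℝ) (hα : 0 < α) (β κ : EReal) (hβ : 0 < β)
    (hκ : β + ((α / 2 : ℝ) : EReal) < κ ∨ (β = ⊤ ∧ κ = ⊤))
    -- the stochastic loss
    (Pξ : MeasureTheory.Measure (SPA.Vec p)) [MeasureTheory.IsProbabilityMeasure Pξ]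
    (F : SPA.Vec d → SPA.Vec p → ℝ) (L : SPA.Vec p → ℝ)
    (hF : SPA.IsStochasticLoss κ F L Pξ)
    (L₀ Q : ℝ) (hL₀ : L₀ = ∫ x, L x ∂Pξ) (hQ : Q = ∫ x, L x ^ 2 ∂Pξ) (hL₀_pos : 0 < L₀)
    -- the version of the algorithm; the first-order one uses an a.e. gradient `gF`
    (v : SPA.Version) (gF : SPA.Vec d → SPA.Vec p → SPA.Vec d)
    (hgF : v = SPA.Version.firstOrder → SPA.IsAEGradient β α F Pξ gF)
    -- the constraint set, the starting point and the parameters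
    (S : Set (SPA.Vec d)) (hS : IsClosed S)
    (w1 : SPA.Vec d) (hw1 : w1 ∈ S ∩ SPA.box β)
    (ρ τ η : ℝ) (hρ : 0 < ρ) (hτ : 0 ≤ τ) (hρτ : 1 < ρ + τ)
    (hη : η = α / (3 * ρ * √(d : ℝ) * L₀))
    (K M : ℕ) (hK : 0 < K) (hM : 0 < M)
    -- a run of the algorithm
    {Ω : Type*} [MeasurableSpace Ω] (P : MeasureTheory.Measure Ω)
    [MeasureTheory.IsProbabilityMeasure P]
    (u : ℕ → Fin M → Ω → SPA.Vec d) (ξ : ℕ → Fin M → Ω → SPA.Vec p) (R : Ω → ℕ)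
    (w : ℕ → Ω → SPA.Vec d)
    (hrun : SPA.IsRun P v F gF Pξ α (S ∩ SPA.box β) w1 η K u ξ R w)
    -- a minimizer of the smoothed objective
    (wα : SPA.Vec d) (hwα : wα ∈ S ∩ SPA.box β)
    (hwα_min : IsMinOn (SPA.smoothed (SPA.expLoss F Pξ) α) (S ∩ SPA.box β) wα) :
    -- the smoothed function is differentiable on the box
    (∀ x ∈ (SPA.box β : Set (SPA.Vec d)),
      DifferentiableAt ℝ (SPA.smoothed (SPA.expLoss F Pξ) α) x) ∧
    -- the distance is measurable as a random variable
    AEMeasurable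
      (fun ω => SPA.statDist (SPA.smoothed (SPA.expLoss F Pξ) α) (S ∩ SPA.box β) (w (R ω) ω)) P ∧
    -- the convergence bound
    (∀ Δ : ℝ,
      SPA.smoothed (SPA.expLoss F Pξ) α w1 - SPA.smoothed (SPA.expLoss F Pξ) α wα ≤ Δ →
      ∫⁻ ω, SPA.statDist (SPA.smoothed (SPA.expLoss F Pξ) α) (S ∩ SPA.box β) (w (R ω) ω) ^ 2 ∂P ≤
        ENNReal.ofReal
          (SPA.constC1 ρ τ * (2 * α⁻¹ * √(d : ℝ) * L₀ * Δ / K) +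
            SPA.constC2 ρ τ M * (v.factor d * Q / M))) ∧
    -- the bound on admissible `Δ`
    (∀ ws : SPA.Vec d, ws ∈ S ∩ SPA.box β →
      IsMinOn (SPA.expLoss F Pξ) (S ∩ SPA.box β) ws →
      ((SPA.smoothed (SPA.expLoss F Pξ) α w1 - SPA.smoothed (SPA.expLoss F Pξ) α wα : ℝ) : EReal) ≤
        min (2 * β * ((√(d : ℝ) * L₀ : ℝ) : EReal))
          ((SPA.expLoss F Pξ w1 - SPA.expLoss F Pξ ws + α * L₀ * √((d : ℝ) / 3) : ℝ) : EReal)) := by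
  set A : Set (SPA.Vec d) := S ∩ SPA.box β with hA
  have hAcl : IsClosed A := hS.inter (SPA.isClosed_box β)
  have hAβ : A ⊆ SPA.box β := Set.inter_subset_right
  have hm : SPA.HasMargin d β κ α := SPA.hasMargin_of_lt d hβ hκ
  -- A global Lipschitz extension of `f` has the same smoothing near `box β`, so all smoothness
  -- arguments can be carried out on the whole space.
  obtain ⟨g, hg, hfg⟩ :=
    (SPA.lipschitzOnWith_expLoss hF (C := ⟨L₀, hL₀_pos.le⟩) hL₀).extend_real
  have hev : ∀ x ∈ (SPA.box β : Set (SPA.Vec d)),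
      SPA.smoothed (SPA.expLoss F Pξ) α =ᶠ[𝓝 x] SPA.smoothed g α := fun x hx =>
    SPA.smoothed_eventuallyEq hm hfg hx
  have hval : ∀ x ∈ A, SPA.smoothed (SPA.expLoss F Pξ) α x = SPA.smoothed g α x := fun x hx =>
    (hev x (hAβ hx)).eq_of_nhds
  have hdiff : Differentiable ℝ (SPA.smoothed g α) := fun x =>
    (SPA.hasGradientAt_smoothed hα hg x).hasFDerivAt.differentiableAt
  have hlip := SPA.norm_gradient_smoothed_sub_le hα hg
  have hdist : SPA.statDist (SPA.smoothed (SPA.expLoss F Pξ) α) A =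
      SPA.statDist (SPA.smoothed g α) A := SPA.statDist_congr fun x hx => hev x (hAβ hx)
  have hdpos : (0 : ℝ) < d := by exact_mod_cast hd
  have hℓpos : 0 < 2 * α⁻¹ * √(d : ℝ) * L₀ := by positivity
  have hQ0 : 0 ≤ Q := hQ ▸ integral_nonneg fun x => sq_nonneg _
  have hυ : 0 ≤ v.factor d := by cases v <;> simp [SPA.Version.factor]
  refine ⟨fun x hx => (hdiff x).congr_of_eventuallyEq (hev x hx), ?_, fun Δ hΔ => ?_,
    fun ws hws hws_min => ?_⟩
  · rw [hdist]
    have hcont : Continuous (gradient (SPA.smoothed g α)) :=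
      (LipschitzWith.of_dist_le_mul (K := ⟨_, hℓpos.le⟩) fun x y => by
        rw [dist_eq_norm, dist_eq_norm]; exact hlip x y).continuous
    exact hrun.aemeasurable_output (SPA.measurable_statDist hAcl hcont.continuousOn)
  · obtain ⟨Φ, hΦ, hdir⟩ := SPA.exists_oracle_direction hd hα hβ hm hF (hL₀ ▸ hL₀_pos.le) v hgF M
    rw [← hQ] at hΦ
    rw [hval w1 hw1, hval wα hwα] at hΔ
    rw [hdist]
    refine hrun.lintegral_statDist_sq_le hα hw1 hAcl hAβ hK hM (mul_nonneg hυ hQ0) hΦ hdir hdiff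
      hℓpos hlip (fun y hy => SPA.gradient_congr_of_eventuallyEq (hev y (hAβ hy))) hρ hτ hρτ ?_
      fun y hy => ?_
    · rw [hη]; field_simp
    · have h : SPA.smoothed (SPA.expLoss F Pξ) α wα ≤ SPA.smoothed (SPA.expLoss F Pξ) α y :=
        hwα_min hy
      rw [hval wα hwα, hval y hy] at h
      linarith
  · have h0 : (0 : SPA.Vec d) ∈ (SPA.box ((α / 2 : ℝ) : EReal) : Set (SPA.Vec d)) := fun i => by
      simpa using (half_pos hα).le
    have hgval : ∀ x ∈ A, SPA.expLoss F Pξ x = g x := fun x hx =>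
      hfg (by simpa using hm.add_mem (hAβ hx) h0)
    rw [hval w1 hw1, hval wα hwα]
    refine le_min ?_ ?_
    · induction β with
      | bot => simp at hβ
      | top =>
        rw [EReal.mul_top_of_pos (by norm_num), EReal.top_mul_coe_of_pos (by positivity)]
        exact le_top
      | coe b =>
        rw [show (2 : EReal) = ((2 : ℝ) : EReal) by norm_cast, ← EReal.coe_mul, ← EReal.coe_mul,
          EReal.coe_le_coe_iff]
        have hnorm : ‖w1 - wα‖ ≤ √(d : ℝ) * (2 * b) := by
          have hb : 0 < b := by exact_mod_cast hβ
          refine SPA.norm_le_sqrt_mul_of_forall_abs_le (by positivity) fun i => ?_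
          have h1 := EReal.coe_le_coe_iff.1 (hAβ hw1 i)
          have h2 := EReal.coe_le_coe_iff.1 (hAβ hwα i)
          have h3 := abs_sub (w1 i) (wα i)
          rw [PiLp.sub_apply]
          linarith
        calc SPA.smoothed g α w1 - SPA.smoothed g α wα ≤ L₀ * ‖w1 - wα‖ :=
              (le_abs_self _).trans (SPA.abs_smoothed_sub_smoothed_le hα hg w1 wα)
          _ ≤ L₀ * (√(d : ℝ) * (2 * b)) := by gcongr
          _ = 2 * b * (√(d : ℝ) * L₀) := by ring
    · rw [EReal.coe_le_coe_iff, hgval w1 hw1, hgval ws hws]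
      have h1 : SPA.smoothed g α w1 - g w1 ≤ L₀ * (α / 2 * √((d : ℝ) / 3)) :=
        (le_abs_self _).trans (SPA.abs_smoothed_sub_le hα hg w1)
      have h2 : -(L₀ * (α / 2 * √((d : ℝ) / 3))) ≤ SPA.smoothed g α wα - g wα :=
        (abs_le.1 (SPA.abs_smoothed_sub_le hα hg wα)).1
      have h3 : SPA.expLoss F Pξ ws ≤ SPA.expLoss F Pξ wα := hws_min hwα
      rw [hgval ws hws, hgval wα hwα] at h3
      linarith
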